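/- Let $\mathbb F_q$ be a finite field with $q$ elements, $A=\mathbb F_q[T]$, $k=\mathbb F_q(T)$, and let $\bar k$ be an algebraic closure of $k$. The places $v$ of $k$ are normalized by $v(x)=\deg_T(l)\,v_l(x)$ for a monic irreducible $l\in A$ ($v_l$ being the $l$-adic valuation), and $v_\infty(x)=-\deg_T(x)$ at infinity. If $L/k$ is a finite extension, a place $w$ of $L$ is a valuation $w$ of $L$ extending one of these $v$, and $n_w=[L_w:k_v]$ denotes the degree of the completions. The Weil height of $x\in\bar k$ is $$h(x)=\frac1{[k(x):k]}\sum_{w\text{ place of }k(x)} n_w\max\{0,-w(x)\}.$$ Let $\bar k\{\tau\}$ be the ring of polynomials in $\tau: z\mapsto z^q$ with coefficients in $\bar k$, under composition. A Drinfeld module of rank $d\ge 1$ over $\bar k$ is a homomorphism of $\mathbb F_q$-algebras $\Phi:A\to\bar k\{\tau\}$ with $\Phi(T)=\sum_{i=0}^d a_i\tau^i$, $a_0=T$, $a_d\ne0$. Put $k(\Phi)=k(a_1,\dots,a_d)$, $c(\Phi)=[k(\Phi):k]$ and $$h(\Phi)=\frac1{c(\Phi)}\sum_{w\text{ place of }k(\Phi)}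 n_w\max_{0\le i\le d}\{0,-w(a_i)\}.$$ The canonical height of $x\in\bar k$ is $\hat h(x)=\lim_{n\to\infty} h(\Phi(T^n)(x))/q^{dn}$. A point $x\in\bar k$ is a torsion point if $\Phi(a)(x)=0$ for some $a\in A\setminus\{0\}$. **Theorem.** Let $\Phi$ be a Drinfeld module of rank $d$ over $\bar k$, and set $$c_2=q^{5d\,(2(d+1)h(\Phi)+1)\,c(\Phi)^2}.$$ Then for every $x\in\bar k$ that is not a torsion point, with $D=[k(x):k]$, the limit defining $\hat h(x)$ exists and $$\hat h(x)\ \ge\ \frac1{c_2^{\,D^2}}.$$ -/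

import Mathlib

noncomputable section

open Polynomial
open scoped NNReal IntermediateField

namespace DrinfeldHeight

/-- The rational function field `k = 𝔽_q(T)`; `T` is `RatFunc.X`, and `A = 𝔽_q[T]` is `F[X]`. -/
abbrev k (F : Type*) [Field F] : Type _ := RatFunc F

/-- A fixed algebraic closure of `k = 𝔽_q(T)`. -/
abbrev kbar (F : Type*) [Field F] : Type _ := AlgebraicClosure (k F)

/-! ### Places and the Weil height -/

section Places

variable (F : Type*) [Field F] [Fintype F]

theorem one_lt_card : (1 : ℝ≥0) < (Fintype.card F : ℝ≥0) := by
  exact_mod_cast Fintype.one_lt_card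

/-- Places of `k`: one for each monic irreducible `l ∈ A`, and the place at infinity (`none`). -/
abbrev BasePlace : Type _ := Option {l : F[X] // l.Monic ∧ Irreducible l}

variable {F} in
/-- The prime ideal `(l)` of `A`. -/
def primeIdeal (l : {l : F[X] // l.Monic ∧ Irreducible l}) :
    IsDedekindDomain.HeightOneSpectrum F[X] where
  asIdeal := Ideal.span {l.1}
  isPrime := (Ideal.span_singleton_prime l.2.2.ne_zero).2 l.2.2.prime
  ne_bot := by simpa using l.2.2.ne_zero

variable {F} in
theorem one_lt_card_pow (l : {l : F[X] // l.Monic ∧ Irreducible l}) :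
    (1 : ℝ≥0) < (Fintype.card F : ℝ≥0) ^ l.1.natDegree :=
  one_lt_pow₀ (one_lt_card F) l.2.2.natDegree_pos.ne'

open Classical in
/-- The absolute value `x ↦ q ^ deg_T(x)` on `k`, that is `q ^ (-v_∞(x))` with
`v_∞ = -deg_T`. -/
def inftyAbv : AbsoluteValue (k F) ℝ where
  toFun x := (WithZeroMulInt.toNNReal (ne_zero_of_lt (one_lt_card F))
    (RatFunc.inftyValuation F x) : ℝ≥0)
  map_mul' _ _ := by simp
  nonneg' _ := NNReal.zero_le_coe
  eq_zero' _ := by simp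
  add_le' x y := by
    have h_mono := (WithZeroMulInt.toNNReal_strictMono (one_lt_card F)).monotone
    have h := h_mono ((RatFunc.inftyValuation F).map_add x y)
    rw [h_mono.map_max] at h
    exact_mod_cast h.trans (max_le_add_of_nonneg bot_le bot_le)

/-- The normalized absolute value `x ↦ q ^ (-v(x))` of a place `v` of `k`, where
`v = deg_T(l) · v_l` at a monic irreducible `l`, and `v = -deg_T` at infinity. -/
def baseAbv : BasePlace F → AbsoluteValue (k F) ℝ
  | none => inftyAbv F
  | some l => (primeIdeal l).adicAbv (one_lt_card_pow l)

end Places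

section LocalDegree

variable {K L : Type*} [Field K] [Field L] [Algebra K L]

/-- The inclusion `K → L` for the topologies given by `v` and `w`. -/
def withAbsMap (v : AbsoluteValue K ℝ) (w : AbsoluteValue L ℝ) : WithAbs v →+* WithAbs w :=
  (WithAbs.equiv w).symm.toRingHom.comp ((algebraMap K L).comp (WithAbs.equiv v).toRingHom)

theorem continuous_withAbsMap (v : AbsoluteValue K ℝ) (w : AbsoluteValue L ℝ)
    (h : w.LiesOver v) : Continuous (withAbsMap v w) := by
  refine AddMonoidHomClass.continuous_of_bound (withAbsMap v w) 1 fun x => ?_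
  have := congrArg (fun u : AbsoluteValue K ℝ => u x.ofAbs) h.comp_eq
  rw [one_mul]
  exact this.le

/-- The map of completions `K_v → L_w`. -/
def completionMap (v : AbsoluteValue K ℝ) (w : AbsoluteValue L ℝ) (h : w.LiesOver v) :
    v.Completion →+* w.Completion :=
  UniformSpace.Completion.mapRingHom (withAbsMap v w) (continuous_withAbsMap v w h)

/-- The local degree `n_w = [L_w : K_v]`. -/
def localDegree (v : AbsoluteValue K ℝ) (w : AbsoluteValue L ℝ) (h : w.LiesOver v) : ℕ :=
  letI := (completionMap v w h).toAlgebra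
  Module.finrank v.Completion w.Completion

end LocalDegree

section Height

variable {F : Type*} [Field F] [Fintype F]

/-- Places `w` of an extension `L` of `k`: a place `v` of `k` together with an extension to `L` of
its normalized absolute value. The corresponding additive valuation is
`w(x) = -log_q |x|_w`. -/
def Place (L : IntermediateField (k F) (kbar F)) : Type _ :=
  Σ v : BasePlace F, {w : AbsoluteValue L ℝ // w.LiesOver (baseAbv F v)}

variable {L : IntermediateField (k F) (kbar F)}

/-- `-w(x) = log_q |x|_w` for `x ≠ 0`. (For `x = 0` this is `0` instead of `-∞`, which does not
matter as only `max {0, -w(x)}` is used.) -/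
def Place.negVal (w : Place L) (x : L) : ℝ := Real.logb (Fintype.card F) (w.2.1 x)

/-- `n_w = [L_w : k_v]`. -/
def Place.degree (w : Place L) : ℕ := localDegree (baseAbv F w.1) w.2.1 w.2.2

/-- For `x = (x_i)` a finite family in `L`, finite over `k`, this is
`(1 / [L : k]) ∑_w n_w max_i {0, -w(x_i)}`, summed over all places `w` of `L`. -/
def heightOver (L : IntermediateField (k F) (kbar F)) {ι : Type*} (x : ι → L) : ℝ :=
  (1 / (Module.finrank (k F) L : ℝ)) *
    ∑ᶠ w : Place L, (w.degree : ℝ) * ⨆ i, max 0 (w.negVal (x i))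

/-- The logarithmic (Weil) height of `x ∈ k̄`, computed over `k(x)`. -/
def height (x : kbar F) : ℝ :=
  heightOver (k F)⟮x⟯ (fun _ : Unit => IntermediateField.AdjoinSimple.gen (k F) x)

end Height

/-! ### Drinfeld modules -/

section Drinfeld

variable (F : Type*) [Field F] [Fintype F]

/-- The Frobenius `τ : z ↦ z ^ q`, as an `𝔽_q`-linear endomorphism of `k̄`. -/
def tau : Module.End F (kbar F) := (FiniteField.frobeniusAlgHom F (kbar F)).toLinearMap

/-- The ring `k̄{τ}` of endomorphisms given by the polynomials `∑ a_i τ^i` with `a_i ∈ k̄`: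
the `𝔽_q`-algebra generated by `τ` and the homotheties `z ↦ a z`. -/
def twistedRing : Subalgebra F (Module.End F (kbar F)) :=
  Algebra.adjoin F (insert (tau F) (Set.range (LinearMap.mulLeft F : kbar F → _)))

/-- A Drinfeld module of rank `d ≥ 1` over `k̄`: a homomorphism of `𝔽_q`-algebras
`Φ : A → k̄{τ}` with `Φ(T) = ∑_{i=0}^d a_i τ^i`, `a_0 = T`, `a_d ≠ 0`. (It is then injective.) -/
structure DrinfeldModule (d : ℕ) where
  /-- The homomorphism `Φ`. -/
  toAlgHom : F[X] →ₐ[F] twistedRing F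
  /-- The coefficients `a_0, …, a_d` of `Φ(T)`. -/
  coeff : Fin (d + 1) → kbar F
  map_T : (toAlgHom X : Module.End F (kbar F)) =
    ∑ i : Fin (d + 1), LinearMap.mulLeft F (coeff i) * tau F ^ (i : ℕ)
  coeff_zero : coeff 0 = algebraMap (k F) (kbar F) RatFunc.X
  coeff_last : coeff (Fin.last d) ≠ 0
  rank_pos : 0 < d

end Drinfeld

namespace DrinfeldModule

variable {F : Type*} [Field F] [Fintype F] {d : ℕ} (Φ : DrinfeldModule F d)

/-- `Φ(a)(x)`. -/
def act (a : F[X]) (x : kbar F) : kbar F := (Φ.toAlgHom a : Module.End F (kbar F)) x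

/-- `x` is a torsion point if `Φ(a)(x) = 0` for some `a ∈ A \ {0}`. -/
def IsTorsion (x : kbar F) : Prop := ∃ a : F[X], a ≠ 0 ∧ Φ.act a x = 0

/-- The field of coefficients `k(Φ) = k(a_1, …, a_d)`. -/
def coeffField : IntermediateField (k F) (kbar F) :=
  IntermediateField.adjoin (k F) (Set.range fun i : Fin d => Φ.coeff i.succ)

theorem coeff_mem (i : Fin (d + 1)) : Φ.coeff i ∈ Φ.coeffField := by
  refine Fin.cases ?_ (fun j => ?_) i
  · rw [Φ.coeff_zero]
    exact Φ.coeffField.algebraMap_mem _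
  · exact IntermediateField.subset_adjoin _ _ ⟨j, rfl⟩

/-- `c(Φ) = [k(Φ) : k]`. -/
def coeffDegree : ℕ := Module.finrank (k F) Φ.coeffField

/-- The height `h(Φ) = (1 / c(Φ)) ∑_w n_w max_{0 ≤ i ≤ d} {0, -w(a_i)}`, over the places `w` of
`k(Φ)`. -/
def modHeight : ℝ := heightOver Φ.coeffField fun i => ⟨Φ.coeff i, Φ.coeff_mem i⟩

/-- The sequence `h(Φ(T^n)(x)) / q^{dn}`. -/
def heightSeq (x : kbar F) (n : ℕ) : ℝ :=
  height (Φ.act (X ^ n) x) / (Fintype.card F : ℝ) ^ (d * n)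

/-- The canonical height `ĥ(x) = lim_n h(Φ(T^n)(x)) / q^{dn}`. -/
def canonicalHeight (x : kbar F) : ℝ := Filter.limUnder Filter.atTop (Φ.heightSeq x)

end DrinfeldModule

end DrinfeldHeight

end

noncomputable section

open Polynomial
open scoped NNReal IntermediateField

namespace DrinfeldHeight

/-! ### Extensions of a complete field generated by a dense subfield -/

section Local

open scoped TensorProduct

variable {k E C L M : Type*} [Field k] [NontriviallyNormedField E] [Algebra k E]
  [Field L] [Algebra k L] [NormedField M] [NormedAlgebra E M]
  [Algebra k M] [IsScalarTower k E M] [Algebra L M] [IsScalarTower k L M]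

/-! Let `x` be non-torsion and `n = D c(Φ)`, a bound for the degree of `k(x) k(Φ)` over `k`. The
`q^N` points `Φ(a)(x)` with `deg a < N` are distinct and lie in this field. If `q^{dN} ĥ(x) ≤ 1`,
all of them have height at most `4 h(Φ) + 1` (`height_act_le`). But a quantitative Northcott theorem
(`card_le_of_height_le`) allows at most `n q^{(⌊nH⌋+1)(n+1)}` points of degree at most `n` and
height at most `H`. For `N = ⌊5Hn²⌋` this is less than `q^N`, so `ĥ(x) > q^{-dN}`.

The height bound comes from `height_act_X`: `h(Φ(T)(y))` and `q^d h(y)` differ by at most `4 h(Φ)`.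
This makes the sequence defining `ĥ` Cauchy and, when iterated, bounds `h` in terms of `ĥ`. The
Northcott count comes from scaling a minimal polynomial to a primitive polynomial over `A`: its
coefficients then have `T`-degree at most `[k(y):k] h(y)`.

Both need a height that can be computed in any finite extension `L/k`, separable or not. The key is
`localDegree_eq`: `n_w` is `[L:k]_i` times the number of embeddings of `L` into an algebraic closure
of `k_v` that induce `w`. These embeddings are counted by `[L_w:k_v]_s`, so the point is that
`[L_w:k_v]_i = [L:k]_i = p^e`. The inequality `≤` holds because `L_w = k_v L`. For `≥`, the
perfectness of `𝔽_q` gives `[k:k^{p^e}] ≤ p^e`, which forces `L` to contain a `p^e`-th root of a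
uniformizer of `v`, an element that is not a proper power in `k_v`. The height is then `1/[L:k]_s`
times an unweighted sum over embeddings. -/

/-- The comparison map `E ⊗ L → M` of a common extension `M` of `E` and `L`. -/
def compositumMap (k E L M : Type*) [Field k] [Field E] [Algebra k E] [Field L] [Algebra k L]
    [Field M] [Algebra E M] [Algebra k M] [IsScalarTower k E M] (σ : L →ₐ[k] M) :
    E ⊗[k] L →ₐ[E] M :=
  Algebra.TensorProduct.lift (Algebra.ofId E M) σ fun _ _ => Commute.all _ _

theorem compositumMap_tmul {k E L M : Type*} [Field k] [Field E] [Algebra k E] [Field L]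
    [Algebra k L] [Field M] [Algebra E M] [Algebra k M] [IsScalarTower k E M] (σ : L →ₐ[k] M)
    (e : E) (x : L) : compositumMap k E L M σ (e ⊗ₜ x) = e • σ x := by
  simp [compositumMap, Algebra.ofId_apply, Algebra.smul_def]

/-- A completion of a finite extension `L` of `k` is generated by `L` over the completion of
`k`. -/
theorem compositumMap_surjective [CompleteSpace E] [FiniteDimensional k L]
    (hL : DenseRange (algebraMap L M)) :
    Function.Surjective (compositumMap k E L M (IsScalarTower.toAlgHom k L M)) := by
  set f := (compositumMap k E L M (IsScalarTower.toAlgHom k L M)).toLinearMap with hf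
  have hclosed : IsClosed (LinearMap.range f : Set M) :=
    Submodule.closed_of_finiteDimensional (LinearMap.range f)
  have hsub : Set.range (algebraMap L M) ⊆ (LinearMap.range f : Set M) := by
    rintro _ ⟨x, rfl⟩
    exact ⟨1 ⊗ₜ x, by simp [hf, compositumMap_tmul]⟩
  intro m
  have : m ∈ closure (Set.range (algebraMap L M)) := hL m
  obtain ⟨z, hz⟩ := (closure_minimal hsub hclosed) this
  exact ⟨z, hz⟩

theorem finiteDimensional_of_denseRange [CompleteSpace E] [FiniteDimensional k L]
    (hL : DenseRange (algebraMap L M)) : FiniteDimensional E M :=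
  Module.Finite.of_surjective (compositumMap k E L M (IsScalarTower.toAlgHom k L M)).toLinearMap
    (compositumMap_surjective hL)

/-- An embedding of `L` which is isometric for the norm of `M` stays isometric after extension
of scalars from `k` to `E`. -/
theorem norm_compositumMap_eq [FiniteDimensional k L] (hk : DenseRange (algebraMap k E))
    [NormedField C] [NormedAlgebra E C] [Algebra k C] [IsScalarTower k E C]
    (σ : L →ₐ[k] C) (hσ : ∀ x, ‖σ x‖ = ‖algebraMap L M x‖) (z : E ⊗[k] L) :
    ‖compositumMap k E L C σ z‖ =
      ‖compositumMap k E L M (IsScalarTower.toAlgHom k L M) z‖ := by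
  let b := Module.finBasis k L
  let φ : (Fin (Module.finrank k L) → E) → ℝ := fun e => ‖∑ i, e i • σ (b i)‖
  let ψ : (Fin (Module.finrank k L) → E) → ℝ := fun e => ‖∑ i, e i • algebraMap L M (b i)‖
  have hφ : Continuous φ := by fun_prop
  have hψ : Continuous ψ := by fun_prop
  have hd : DenseRange (Pi.map fun _ : Fin (Module.finrank k L) => algebraMap k E) :=
    DenseRange.piMap fun _ => hk
  -- Both norms are continuous in the coordinates, and by isometry they agree on the dense subset of
  -- vectors with coordinates in `k`.
  have heq : φ = ψ := by
    refine hd.equalizer hφ hψ ?_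
    funext c
    have h1 : ∑ i, algebraMap k E (c i) • σ (b i) = σ (∑ i, c i • b i) := by
      simp [map_sum, algebraMap_smul]
    have h2 : ∑ i, algebraMap k E (c i) • algebraMap L M (b i) =
        algebraMap L M (∑ i, c i • b i) := by
      rw [map_sum]
      refine Finset.sum_congr rfl fun i _ => ?_
      rw [algebraMap_smul, Algebra.smul_def, Algebra.smul_def, map_mul,
        ← IsScalarTower.algebraMap_apply]
    simp only [φ, ψ, Function.comp_apply, Pi.map_apply, h1, h2, hσ]
  have hz := (Algebra.TensorProduct.basis E b).sum_repr z
  have := congrFun heq ((Algebra.TensorProduct.basis E b).repr z)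
  rw [← hz, map_sum, map_sum]
  simpa [φ, ψ, compositumMap_tmul] using this

variable [CompleteSpace E] [IsUltrametricDist E]

/-- A complete ultrametric norm extends uniquely to `M`, so the norm of `M` is the spectral norm,
which depends only on minimal polynomials over `E`. -/
theorem spectralNorm_algHom [Algebra.IsAlgebraic E M] [Field C] [Algebra E C] (φ : M →ₐ[E] C)
    (m : M) : spectralNorm E C (φ m) = ‖m‖ := by
  rw [NormedAlgebra.norm_eq_spectralNorm E m, spectralNorm, spectralNorm,
    minpoly.algHom_eq φ φ.toRingHom.injective]

/-- The embeddings of `L` inducing the norm of its completion `M` are the embeddings of `M`. -/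
theorem card_isometric_embeddings [FiniteDimensional k L] (hk : DenseRange (algebraMap k E))
    (hL : DenseRange (algebraMap L M)) [Field C] [Algebra E C] [Algebra.IsAlgebraic E C]
    [IsAlgClosed C] [Algebra k C] [IsScalarTower k E C] :
    Nat.card {σ : L →ₐ[k] C // ∀ x, spectralNorm E C (σ x) = ‖algebraMap L M x‖} =
      Field.finSepDegree E M := by
  have hfin : FiniteDimensional E M := finiteDimensional_of_denseRange (k := k) hL
  have hsurj := compositumMap_surjective (k := k) (E := E) hL
  rw [Field.finSepDegree_eq_of_isAlgClosed E M C]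
  symm
  let r (φ : M →ₐ[E] C) : {σ : L →ₐ[k] C // ∀ x, spectralNorm E C (σ x) = ‖algebraMap L M x‖} :=
    ⟨(φ.restrictScalars k).comp (IsScalarTower.toAlgHom k L M), fun x =>
      spectralNorm_algHom φ (algebraMap L M x)⟩
  refine Nat.card_eq_of_bijective r ⟨fun φ φ' h => ?_, fun σ => ?_⟩
  · ext m
    obtain ⟨z, rfl⟩ := hsurj m
    have hr (x : L) : φ (algebraMap L M x) = φ' (algebraMap L M x) :=
      DFunLike.congr_fun (congrArg Subtype.val h) x
    induction z with
    | zero => simp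
    | add a b ha hb => simp [ha, hb]
    | tmul e x => simp [compositumMap_tmul, hr]
  -- An isometric `σ` extends to `M`: the maps from `E ⊗ L` to `M` and to `C` have equal norms, so
  -- the second kills the kernel of the first.
  · let := spectralNorm.normedField E C
    let := spectralNorm.normedAlgebra E C
    have hnorm := norm_compositumMap_eq (M := M) hk σ.1 σ.2
    have hker : RingHom.ker (compositumMap k E L M (IsScalarTower.toAlgHom k L M)) ≤
        RingHom.ker (compositumMap k E L C σ.1) := fun z hz => by
      rw [RingHom.mem_ker] at hz ⊢
      rw [← norm_eq_zero, hnorm, hz, norm_zero]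
    let φ : M →ₐ[E] C := AlgHom.liftOfSurjective _ hsurj (compositumMap k E L C σ.1) hker
    have hφ (z : E ⊗[k] L) : φ (compositumMap k E L M (IsScalarTower.toAlgHom k L M) z) =
        compositumMap k E L C σ.1 z := AlgHom.liftOfSurjective_apply _ _ _ _ z
    refine ⟨φ, Subtype.ext (AlgHom.ext fun x => ?_)⟩
    have := hφ (1 ⊗ₜ x)
    rw [compositumMap_tmul, compositumMap_tmul, one_smul, one_smul] at this
    exact this

end Local

/-! ### Inseparable degrees of composita -/

section Inseparable

open scoped TensorProduct

variable {k E L M : Type*} [Field k] [Field E] [Algebra k E] [Field L] [Algebra k L]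
  [Field M] [Algebra E M] [Algebra k M] [IsScalarTower k E M] [Algebra L M] [IsScalarTower k L M]

/-- A basis of `L` over its maximal separable subextension still spans `M = E · L` over the
separable closure of `E` in `M`, because separable elements over `k` stay separable over `E`. -/
theorem finInsepDegree_compositum_le [FiniteDimensional k L]
    (hsurj : Function.Surjective (compositumMap k E L M (IsScalarTower.toAlgHom k L M))) :
    Field.finInsepDegree E M ≤ Field.finInsepDegree k L := by
  let S := separableClosure k L
  let S' := separableClosure E M
  have hS (s : S) : algebraMap L M s ∈ S' := by
    have h1 : IsSeparable k (s : L) := mem_separableClosure_iff.1 s.2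
    have h2 : IsSeparable k (algebraMap L M s) :=
      h1.map (IsScalarTower.toAlgHom k L M) (algebraMap L M).injective
    exact mem_separableClosure_iff.2 (h2.tower_top E)
  let c := Module.finBasis S L
  have hspan : Submodule.span S' (Set.range fun i => algebraMap L M (c i)) = ⊤ := by
    rw [eq_top_iff]
    rintro m -
    have hLmem (x : L) : algebraMap L M x ∈
        Submodule.span S' (Set.range fun i => algebraMap L M (c i)) := by
      rw [← c.sum_repr x, map_sum]
      refine Submodule.sum_mem _ fun i _ => ?_
      have : algebraMap L M (c.repr x i • c i) =
          (⟨_, hS (c.repr x i)⟩ : S') • algebraMap L M (c i) := by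
        rw [Algebra.smul_def, map_mul]
        rfl
      rw [this]
      exact Submodule.smul_mem _ _ (Submodule.subset_span ⟨i, rfl⟩)
    obtain ⟨z, rfl⟩ := hsurj m
    induction z with
    | zero => simp
    | add a b ha hb =>
      rw [map_add]
      exact Submodule.add_mem _ ha hb
    | tmul e x =>
      rw [compositumMap_tmul, ← algebraMap_smul S' e]
      exact Submodule.smul_mem _ _ (hLmem x)
  calc Field.finInsepDegree E M = Module.finrank S' M := rfl
    _ = Module.finrank S' (⊤ : Submodule S' M) := (finrank_top S' M).symm
    _ ≤ Fintype.card (Fin (Module.finrank S L)) := by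
      rw [← hspan]
      exact finrank_range_le_card _
    _ = Field.finInsepDegree k L := by
      rw [Fintype.card_fin]
      rfl

/-- The minimal polynomial of `β` is `X^{p^n} - y`. If `n < e`, then `a` would be a `p^{e-n}`-th
power in `E`. So `E(β)` is purely inseparable of degree at least `p^e`, and this degree divides the
inseparable degree of `M`. -/
theorem pow_le_finInsepDegree [FiniteDimensional E M] (p e : ℕ) [ExpChar E p] (a : E)
    (ha : ∀ (j : ℕ) (z : E), z ^ p ^ j = a → j = 0) (β : M) (hβ : β ^ p ^ e = algebraMap E M a) :
    p ^ e ≤ Field.finInsepDegree E M := by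
  have hp : IsPurelyInseparable E E⟮β⟯ :=
    (IntermediateField.isPurelyInseparable_adjoin_simple_iff_pow_mem E M p).2 ⟨e, a, hβ.symm⟩
  obtain ⟨n, y, hn⟩ := IsPurelyInseparable.minpoly_eq_X_pow_sub_C E p
    (IntermediateField.AdjoinSimple.gen E β)
  have hp0 : 0 < p := expChar_pos E p
  have hpow : β ^ p ^ n = algebraMap E M y := by
    have h1 := minpoly.aeval E β
    rw [← IntermediateField.minpoly_gen, hn] at h1
    simpa [sub_eq_zero] using h1
  have hdeg : Module.finrank E E⟮β⟯ = p ^ n := by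
    rw [IntermediateField.adjoin.finrank (Algebra.IsIntegral.isIntegral β),
      ← IntermediateField.minpoly_gen, hn, natDegree_X_pow_sub_C]
  have hen : e ≤ n := by
    by_contra! h
    have h2 : y ^ p ^ (e - n) = a := by
      apply (algebraMap E M).injective
      rw [map_pow, ← hpow, ← hβ, ← pow_mul, ← pow_add, Nat.add_sub_cancel' h.le]
    have := ha _ _ h2
    omega
  have hmul := Field.finInsepDegree_mul_finInsepDegree_of_isAlgebraic E E⟮β⟯ M
  rw [IsPurelyInseparable.finInsepDegree_eq, hdeg] at hmul
  have hpos : 0 < Field.finInsepDegree E M := NeZero.pos _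
  calc p ^ e ≤ p ^ n := Nat.pow_le_pow_right hp0 hen
    _ ≤ Field.finInsepDegree E M := Nat.le_of_dvd hpos ⟨_, hmul.symm⟩

end Inseparable

/-! ### Inseparable extensions of a rational function field -/

section Frobenius

/-- As `F` is perfect, `F(T)` is generated over the subfield of `p^e`-th powers by `T` alone, a root
of `X^{p^e} - T^{p^e}`. Positivity records that the dimension is finite, since `finrank` would
otherwise be `0`. -/
theorem finrank_iterateFrobenius_fieldRange_ratFunc (F : Type*) [Field F] (p : ℕ) [ExpChar F p]
    [PerfectField F] [ExpChar (RatFunc F) p] (e : ℕ) :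
    0 < Module.finrank (iterateFrobenius (RatFunc F) p e).fieldRange (RatFunc F) ∧
      Module.finrank (iterateFrobenius (RatFunc F) p e).fieldRange (RatFunc F) ≤ p ^ e := by
  set R := (iterateFrobenius (RatFunc F) p e).fieldRange with hR
  have hp0 : 0 < p ^ e := pow_pos (expChar_pos F p) e
  have hmem : (RatFunc.X : RatFunc F) ^ p ^ e ∈ R := ⟨RatFunc.X, by simp [iterateFrobenius_def]⟩
  let P : R[X] := X ^ p ^ e - C ⟨_, hmem⟩
  have hP : aeval (RatFunc.X : RatFunc F) P = 0 := by
    simp only [P, map_sub, map_pow, aeval_X, aeval_C, sub_eq_zero]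
    rfl
  have hmonic : P.Monic := monic_X_pow_sub_C _ hp0.ne'
  have hint : IsIntegral R (RatFunc.X : RatFunc F) := ⟨P, hmonic, hP⟩
  have htop : IntermediateField.adjoin R {(RatFunc.X : RatFunc F)} = ⊤ := by
    rw [eq_top_iff]
    intro x _
    have hx : x ∈ (IntermediateField.adjoin F {(RatFunc.X : RatFunc F)}).toSubfield := by
      rw [RatFunc.adjoin_X]
      trivial
    rw [IntermediateField.adjoin_toSubfield] at hx
    refine (Subfield.closure_le (t := (IntermediateField.adjoin R
      {(RatFunc.X : RatFunc F)}).toSubfield)).2 ?_ hx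
    rintro y (⟨c, rfl⟩ | rfl)
    · obtain ⟨b, rfl⟩ := (bijective_iterateFrobenius F p e).2 c
      have : algebraMap F (RatFunc F) (iterateFrobenius F p e b) ∈ R :=
        ⟨algebraMap F (RatFunc F) b, by simp [iterateFrobenius_def]⟩
      exact IntermediateField.algebraMap_mem _ (⟨_, this⟩ : R)
    · exact IntermediateField.mem_adjoin_simple_self R _
  have hfin : Module.finrank R (RatFunc F) = (minpoly R (RatFunc.X : RatFunc F)).natDegree := by
    rw [← IntermediateField.adjoin.finrank hint, htop, IntermediateField.finrank_top']
  rw [hfin]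
  refine ⟨minpoly.natDegree_pos hint, ?_⟩
  calc _ ≤ P.natDegree := natDegree_le_natDegree (minpoly.min R _ hmonic hP)
    _ = p ^ e := natDegree_X_pow_sub_C

variable {k L : Type*} [Field k] [Field L] [Algebra k L] [FiniteDimensional k L] (p : ℕ)
  [ExpChar k p]

theorem exists_finInsepDegree_eq_pow : ∃ e, Field.finInsepDegree k L = p ^ e :=
  haveI : ExpChar (separableClosure k L) p :=
    expChar_of_injective_algebraMap (algebraMap k _).injective p
  IsPurelyInseparable.finrank_eq_pow (separableClosure k L) L p

/-- Over the separable closure the minimal polynomial of `x` is `X^{p^n} - y`, and its degree `p^n`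
divides the inseparable degree `p^e`. -/
theorem pow_finInsepDegree_mem_separableClosure {e : ℕ} (he : Field.finInsepDegree k L = p ^ e)
    (x : L) : x ^ p ^ e ∈ separableClosure k L := by
  let S := separableClosure k L
  have : ExpChar S p := expChar_of_injective_algebraMap (algebraMap k _).injective p
  obtain ⟨n, y, hn⟩ := IsPurelyInseparable.minpoly_eq_X_pow_sub_C S p x
  have hint : IsIntegral S x := Algebra.IsIntegral.isIntegral x
  have hpow : x ^ p ^ n = y := by
    have h1 := minpoly.aeval S x
    rw [hn] at h1
    simpa [sub_eq_zero] using h1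
  have hdvd : p ^ n ∣ p ^ e := by
    have h := minpoly.degree_dvd hint
    rw [hn, natDegree_X_pow_sub_C] at h
    rwa [← he]
  have hmem : x ^ p ^ n ∈ S := hpow ▸ y.2
  obtain ⟨c, hc⟩ := hdvd
  rw [hc, pow_mul]
  exact pow_mem hmem c

/-- If `[k : k ^ (p ^ e)] ≤ p ^ e` where `p ^ e` is the inseparable degree of `L / k`, then the
elements of `k` are `p ^ e`-th powers in `L`. -/
theorem exists_pow_eq_algebraMap [ExpChar L p] {e : ℕ} (he : Field.finInsepDegree k L = p ^ e)
    (hk0 : 0 < Module.finrank (iterateFrobenius k p e).fieldRange k)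
    (hk : Module.finrank (iterateFrobenius k p e).fieldRange k ≤ p ^ e) (a : k) :
    ∃ b : L, b ^ p ^ e = algebraMap k L a := by
  let f := iterateFrobenius L p e
  let i := algebraMap k L
  let S := (separableClosure k L).toSubfield
  have hcomm : (i.fieldRange).map f = ((iterateFrobenius k p e).fieldRange).map i := by
    ext x
    constructor
    · rintro ⟨_, ⟨y, rfl⟩, rfl⟩
      exact ⟨_, ⟨y, rfl⟩, by simp [f, i, iterateFrobenius_def]⟩
    · rintro ⟨_, ⟨y, rfl⟩, rfl⟩
      exact ⟨_, ⟨y, rfl⟩, by simp [f, i, iterateFrobenius_def]⟩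
  have hA : ((i.fieldRange).map f).relfinrank i.fieldRange =
      Module.finrank (iterateFrobenius k p e).fieldRange k := by
    rw [hcomm, RingHom.fieldRange_eq_map i, Subfield.relfinrank_map_map,
      Subfield.relfinrank_top_right]
  have hn : i.fieldRange.relfinrank ⊤ = Module.finrank k L := by
    rw [show i.fieldRange = (⊥ : IntermediateField k L).toSubfield from
      IntermediateField.bot_toSubfield.symm, Subfield.relfinrank_top_right]
    exact IntermediateField.finrank_bot'
  have hle : (i.fieldRange).map f ≤ i.fieldRange := by
    rw [hcomm, RingHom.fieldRange_eq_map i]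
    exact (Subfield.gc_map_comap i).monotone_l le_top
  have hfS : f.fieldRange ≤ S := by
    rintro _ ⟨x, rfl⟩
    simpa [f, S, iterateFrobenius_def] using pow_finInsepDegree_mem_separableClosure p he x
  -- Computing `[L : k^{p^e}]` through `k` and through `L^{p^e}`, and using `[L^{p^e} : k^{p^e}] =
  -- [L : k]`, gives `[L : L^{p^e}] = [k : k^{p^e}] ≤ p^e = [L : S]`. Since `L^{p^e} ⊆ S`, the two
  -- fields coincide, and `S` contains `k`.
  have e1 := Subfield.relfinrank_mul_relfinrank hle le_top
  have e2 := Subfield.relfinrank_mul_relfinrank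
    ((Subfield.gc_map_comap f).monotone_l (le_top (a := i.fieldRange)))
    (le_top (a := (⊤ : Subfield L).map f))
  rw [Subfield.relfinrank_map_map, hn, ← RingHom.fieldRange_eq_map] at e2
  have e3 := Subfield.relfinrank_mul_relfinrank hfS le_top
  have hS : S.relfinrank ⊤ = p ^ e := by
    rw [Subfield.relfinrank_top_right, ← he]
    rfl
  have hpos : 0 < Module.finrank k L := Module.finrank_pos
  have hone : f.fieldRange.relfinrank S = 1 := by
    rw [hA, hn] at e1
    have h4 : f.fieldRange.relfinrank ⊤ = Module.finrank (iterateFrobenius k p e).fieldRange k :=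
      Nat.eq_of_mul_eq_mul_left hpos (by rw [e2, ← e1, mul_comm])
    rw [hS, h4] at e3
    have hp : 0 < p ^ e := pow_pos (expChar_pos k p) e
    have h5 : f.fieldRange.relfinrank S ≤ 1 := by
      by_contra! h
      nlinarith
    have h6 : f.fieldRange.relfinrank S ≠ 0 := by
      intro h
      rw [h, zero_mul] at e3
      omega
    omega
  have hSf : S ≤ f.fieldRange := Subfield.relfinrank_eq_one_iff.1 hone
  obtain ⟨b, hb⟩ := hSf ((separableClosure k L).algebraMap_mem a)
  exact ⟨b, by simpa [f, iterateFrobenius_def] using hb⟩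

end Frobenius

/-- The local degree splits off the global inseparable degree. -/
theorem finInsepDegree_completion_eq {F E L M : Type*} [Field F] [PerfectField F] [Field E]
    [Algebra (RatFunc F) E] [Field L] [Algebra (RatFunc F) L] [FiniteDimensional (RatFunc F) L]
    [Field M] [Algebra E M] [FiniteDimensional E M] [Algebra (RatFunc F) M]
    [IsScalarTower (RatFunc F) E M] [Algebra L M] [IsScalarTower (RatFunc F) L M]
    (hsurj : Function.Surjective
      (compositumMap (RatFunc F) E L M (IsScalarTower.toAlgHom (RatFunc F) L M)))
    (a : RatFunc F)
    (ha : ∀ (m : ℕ) (z : E), z ^ m = algebraMap (RatFunc F) E a → m = 1) :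
    Field.finInsepDegree E M = Field.finInsepDegree (RatFunc F) L := by
  obtain ⟨p, hp⟩ := ExpChar.exists F
  have h1 : ExpChar (RatFunc F) p :=
    expChar_of_injective_algebraMap (algebraMap F (RatFunc F)).injective p
  have h2 : ExpChar L p := expChar_of_injective_algebraMap (algebraMap (RatFunc F) L).injective p
  have h3 : ExpChar E p := expChar_of_injective_algebraMap (algebraMap (RatFunc F) E).injective p
  obtain ⟨e, he⟩ := exists_finInsepDegree_eq_pow (k := RatFunc F) (L := L) p
  obtain ⟨hk0, hk⟩ := finrank_iterateFrobenius_fieldRange_ratFunc F p e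
  -- A `p^e`-th root in `L` of an element that is not a proper power in `E` forces inseparable
  -- degree at least `p^e` over `E`.
  obtain ⟨b, hb⟩ := exists_pow_eq_algebraMap p he hk0 hk a
  refine le_antisymm (finInsepDegree_compositum_le hsurj) ?_
  rw [he]
  rcases hp with _ | hp
  · simpa using Nat.one_le_iff_ne_zero.2 (NeZero.ne (Field.finInsepDegree E M))
  refine pow_le_finInsepDegree p e (algebraMap (RatFunc F) E a) (fun j z hz => ?_)
    (algebraMap L M b) ?_
  · have := ha _ z hz
    by_contra hj
    exact (Nat.one_lt_pow hj hp.one_lt).ne' this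
  · rw [← map_pow, hb, ← IsScalarTower.algebraMap_apply, ← IsScalarTower.algebraMap_apply]

/-! ### The places of the rational function field -/

section BasePlaces

variable {F : Type*} [Field F] [Fintype F]

theorem toNNReal_exp {e : ℝ≥0} (he : e ≠ 0) (n : ℤ) :
    WithZeroMulInt.toNNReal he (WithZero.exp n) = e ^ n := by
  rw [WithZeroMulInt.toNNReal_neg_apply he WithZero.exp_ne_zero]
  rfl

theorem exists_toNNReal_eq_zpow {e : ℝ≥0} (he : e ≠ 0) {x : WithZero (Multiplicative ℤ)}
    (hx : x ≠ 0) : ∃ n : ℤ, WithZeroMulInt.toNNReal he x = e ^ n :=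
  ⟨_, WithZeroMulInt.toNNReal_neg_apply he hx⟩

theorem isNonarchimedean_baseAbv (v : BasePlace F) : IsNonarchimedean (baseAbv F v) := by
  classical
  cases v with
  | some l => exact (primeIdeal l).isNonarchimedean_adicAbv _
  | none =>
    intro x y
    have h_mono := (WithZeroMulInt.toNNReal_strictMono (one_lt_card F)).monotone
    have h := h_mono ((RatFunc.inftyValuation F).map_add x y)
    rw [h_mono.map_max] at h
    exact_mod_cast h

theorem inftyAbv_polynomial {P : F[X]} (hP : P ≠ 0) :
    baseAbv F none (algebraMap F[X] (k F) P) = (Fintype.card F : ℝ) ^ P.natDegree := by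
  classical
  change ((WithZeroMulInt.toNNReal (ne_zero_of_lt (one_lt_card F))
    (RatFunc.inftyValuation F (algebraMap F[X] (k F) P)) : ℝ≥0) : ℝ) = _
  rw [RatFunc.inftyValuation_apply, RatFunc.inftyValuation.polynomial F hP, toNNReal_exp]
  simp

theorem baseAbv_some_polynomial_eq_one_iff (l : {l : F[X] // l.Monic ∧ Irreducible l}) (P : F[X]) :
    baseAbv F (some l) (algebraMap F[X] (k F) P) = 1 ↔ ¬ l.1 ∣ P :=
  ((primeIdeal l).adicAbv_coe_eq_one_iff _ P).trans
    (not_congr Ideal.mem_span_singleton)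

theorem baseAbv_some_self (l : {l : F[X] // l.Monic ∧ Irreducible l}) :
    baseAbv F (some l) (algebraMap F[X] (k F) l.1) =
      ((Fintype.card F : ℝ) ^ l.1.natDegree)⁻¹ := by
  refine ((primeIdeal l).adicAbv_of_algebraMap _ l.1).trans ?_
  change ((WithZeroMulInt.toNNReal (ne_zero_of_lt (one_lt_card_pow l))
    ((primeIdeal l).intValuation l.1) : ℝ≥0) : ℝ) = _
  rw [(primeIdeal l).intValuation_singleton l.2.2.ne_zero rfl, toNNReal_exp]
  simp

/-- The value group of a place of `k` is infinite cyclic, and a generator is attained. -/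
theorem exists_uniformizer (v : BasePlace F) : ∃ (b : ℝ) (π : k F), 1 < b ∧
    baseAbv F v π = b⁻¹ ∧ ∀ x ≠ 0, ∃ n : ℤ, baseAbv F v x = b ^ n := by
  classical
  cases v with
  | none =>
    refine ⟨Fintype.card F, (algebraMap F[X] (k F) X)⁻¹, by exact_mod_cast one_lt_card F, ?_,
      fun x hx => ?_⟩
    · rw [map_inv₀, inftyAbv_polynomial X_ne_zero]
      simp
    · obtain ⟨n, hn⟩ := exists_toNNReal_eq_zpow (ne_zero_of_lt (one_lt_card F))
        (x := RatFunc.inftyValuation F x) (by simpa using hx)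
      exact ⟨n, (congrArg NNReal.toReal hn).trans (by simp)⟩
  | some l =>
    refine ⟨(Fintype.card F : ℝ) ^ l.1.natDegree, algebraMap F[X] (k F) l.1,
      by exact_mod_cast one_lt_card_pow l, baseAbv_some_self l, fun x hx => ?_⟩
    obtain ⟨n, hn⟩ := exists_toNNReal_eq_zpow (ne_zero_of_lt (one_lt_card_pow l))
      (x := (primeIdeal l).valuation (k F) x) (by simpa using hx)
    exact ⟨n, (congrArg NNReal.toReal hn).trans (by simp)⟩

theorem abv_algebraMap_constant {R : Type*} [Field R] [Algebra F R] (w : AbsoluteValue R ℝ)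
    {c : F} (hc : c ≠ 0) : w (algebraMap F R c) = 1 := by
  have h : w (algebraMap F R c) ^ (Fintype.card F - 1) = 1 := by
    rw [← map_pow, ← map_pow, FiniteField.pow_card_sub_one_eq_one c hc, map_one, map_one]
  exact (pow_eq_one_iff_of_nonneg (w.nonneg _)
    (by have := Fintype.one_lt_card (α := F); omega)).1 h

theorem logb_card_pow (n : ℕ) :
    Real.logb (Fintype.card F) ((Fintype.card F : ℝ) ^ n) = n := by
  have h1 : (1 : ℝ) < Fintype.card F := by exact_mod_cast one_lt_card F
  rw [Real.logb_pow, Real.logb_self_eq_one h1, mul_one]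

/-- For `x ≠ 0` in `k`, almost all absolute values of `x` are `1`, and the product formula
holds. -/
theorem finite_and_productFormula {x : k F} (hx : x ≠ 0) :
    {v | baseAbv F v x ≠ 1}.Finite ∧
      ∑ᶠ v, Real.logb (Fintype.card F) (baseAbv F v x) = 0 := by
  classical
  have hsupp {y : k F} (h : {v | baseAbv F v y ≠ 1}.Finite) :
      (Function.support fun v => Real.logb (Fintype.card F) (baseAbv F v y)).Finite :=
    h.subset fun v hv h1 => hv (by simp [h1])
  -- The claim is multiplicative, so it reduces to constants, where every absolute value is `1`, and
  -- to monic irreducibles `l`, where only `l` and `∞` contribute, with `-deg l` and `deg l`.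
  have hmul {y z : k F} (hy0 : y ≠ 0) (hz0 : z ≠ 0)
      (hy : {v | baseAbv F v y ≠ 1}.Finite ∧
        ∑ᶠ v, Real.logb (Fintype.card F) (baseAbv F v y) = 0)
      (hz : {v | baseAbv F v z ≠ 1}.Finite ∧
        ∑ᶠ v, Real.logb (Fintype.card F) (baseAbv F v z) = 0) :
      {v | baseAbv F v (y * z) ≠ 1}.Finite ∧
        ∑ᶠ v, Real.logb (Fintype.card F) (baseAbv F v (y * z)) = 0 := by
    refine ⟨(hy.1.union hz.1).subset fun v hv => ?_, ?_⟩
    · by_contra h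
      simp only [Set.mem_union, Set.mem_ofPred_eq, not_or, not_not] at h
      exact hv (by simp [h.1, h.2])
    · have : (fun v => Real.logb (Fintype.card F) (baseAbv F v (y * z))) = fun v =>
          Real.logb (Fintype.card F) (baseAbv F v y) +
            Real.logb (Fintype.card F) (baseAbv F v z) := by
        funext v
        rw [map_mul, Real.logb_mul ((_root_.map_ne_zero _).2 hy0) ((_root_.map_ne_zero _).2 hz0)]
      rw [this, finsum_add_distrib (hsupp hy.1) (hsupp hz.1), hy.2, hz.2, add_zero]
  have hinv {y : k F} (hy : {v | baseAbv F v y ≠ 1}.Finite ∧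
        ∑ᶠ v, Real.logb (Fintype.card F) (baseAbv F v y) = 0) :
      {v | baseAbv F v y⁻¹ ≠ 1}.Finite ∧
        ∑ᶠ v, Real.logb (Fintype.card F) (baseAbv F v y⁻¹) = 0 := by
    refine ⟨by simpa using hy.1, ?_⟩
    simp only [map_inv₀, Real.logb_inv, finsum_neg_distrib, hy.2, neg_zero]
  have hconst {c : F} (hc : c ≠ 0) : {v | baseAbv F v (algebraMap F (k F) c) ≠ 1}.Finite ∧
      ∑ᶠ v, Real.logb (Fintype.card F) (baseAbv F v (algebraMap F (k F) c)) = 0 := by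
    simp only [abv_algebraMap_constant _ hc]
    simp
  have hC (c : F) : algebraMap F[X] (k F) (C c) = algebraMap F (k F) c := by
    rw [IsScalarTower.algebraMap_apply F F[X] (k F)]
    rfl
  have hmonic (l : {l : F[X] // l.Monic ∧ Irreducible l}) :
      {v | baseAbv F v (algebraMap F[X] (k F) l.1) ≠ 1}.Finite ∧
        ∑ᶠ v, Real.logb (Fintype.card F) (baseAbv F v (algebraMap F[X] (k F) l.1)) = 0 := by
    have hone (v : BasePlace F) (h0 : v ≠ none) (hl : v ≠ some l) :
        baseAbv F v (algebraMap F[X] (k F) l.1) = 1 := by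
      cases v with
      | none => exact absurd rfl h0
      | some l' =>
        rw [baseAbv_some_polynomial_eq_one_iff]
        intro hdvd
        refine hl (congrArg some (Subtype.ext ?_))
        exact eq_of_monic_of_associated l'.2.1 l.2.1
          (l'.2.2.associated_of_dvd l.2.2 hdvd)
    refine ⟨(Set.toFinite {none, some l}).subset fun v hv => ?_, ?_⟩
    · by_contra h
      simp only [Set.mem_insert_iff, Set.mem_singleton_iff, not_or] at h
      exact hv (hone v h.1 h.2)
    · rw [finsum_eq_sum_of_support_subset (s := {none, some l}), Finset.sum_pair (by simp),
        inftyAbv_polynomial l.2.2.ne_zero, baseAbv_some_self, Real.logb_inv, add_neg_cancel]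
      intro v hv
      by_contra h
      simp only [Finset.coe_insert, Finset.coe_singleton, Set.mem_insert_iff,
        Set.mem_singleton_iff, not_or] at h
      exact hv (by simp [hone v h.1 h.2])
  have hinj : Function.Injective (algebraMap F[X] (k F)) := IsFractionRing.injective F[X] (k F)
  have hpoly (P : F[X]) : P ≠ 0 → {v | baseAbv F v (algebraMap F[X] (k F) P) ≠ 1}.Finite ∧
      ∑ᶠ v, Real.logb (Fintype.card F) (baseAbv F v (algebraMap F[X] (k F) P)) = 0 := by
    induction P using WfDvdMonoid.induction_on_irreducible with
    | zero => exact fun h => absurd rfl h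
    | unit u hu =>
      intro _
      obtain ⟨c, hc, rfl⟩ := Polynomial.isUnit_iff.1 hu
      rw [hC]
      exact hconst hc.ne_zero
    | mul a i ha hi ih =>
      intro _
      have hlc : i.leadingCoeff ≠ 0 := leadingCoeff_ne_zero.2 hi.ne_zero
      have hm : (i * C i.leadingCoeff⁻¹).Monic := monic_mul_leadingCoeff_inv hi.ne_zero
      have hirr : Irreducible (i * C i.leadingCoeff⁻¹) :=
        (irreducible_mul_isUnit (isUnit_C.2 (inv_ne_zero hlc).isUnit)).2 hi
      have hi' : i = (i * C i.leadingCoeff⁻¹) * C i.leadingCoeff := by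
        rw [mul_assoc, ← C_mul, inv_mul_cancel₀ hlc, C_1, mul_one]
      rw [hi', map_mul, map_mul, hC]
      refine hmul (mul_ne_zero ?_ ?_) ?_
        (hmul ?_ ?_ (hmonic ⟨_, hm, hirr⟩) (hconst hlc)) (ih ha)
      · exact (map_ne_zero_iff _ hinj).2 hirr.ne_zero
      · simpa using hlc
      · exact (map_ne_zero_iff _ hinj).2 ha
      · exact (map_ne_zero_iff _ hinj).2 hirr.ne_zero
      · simpa using hlc
  have hnum : x.num ≠ 0 := RatFunc.num_ne_zero hx
  have h := hmul ((map_ne_zero_iff _ hinj).2 hnum)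
    (inv_ne_zero ((map_ne_zero_iff _ hinj).2 x.denom_ne_zero))
    (hpoly _ hnum) (hinv (hpoly _ x.denom_ne_zero))
  rwa [← div_eq_mul_inv, RatFunc.num_div_denom] at h

end BasePlaces

/-! ### Local fields -/

section LocalFields

variable {F : Type*} [Field F] [Fintype F]

/-- The completion `k_v`. -/
abbrev kv (v : BasePlace F) : Type _ := (baseAbv F v).Completion

/-- An algebraic closure of `k_v`. -/
abbrev Cv (v : BasePlace F) : Type _ := AlgebraicClosure (kv v)

theorem algebraMap_kv (v : BasePlace F) (x : k F) :
    algebraMap (k F) (kv v) x = ((WithAbs.toAbs (baseAbv F v) x : WithAbs (baseAbv F v)) : kv v) :=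
  rfl

theorem norm_algebraMap_kv (v : BasePlace F) (x : k F) :
    ‖algebraMap (k F) (kv v) x‖ = baseAbv F v x := by
  rw [algebraMap_kv, UniformSpace.Completion.norm_coe]
  rfl

theorem denseRange_algebraMap_kv (v : BasePlace F) : DenseRange (algebraMap (k F) (kv v)) := by
  have h := (UniformSpace.Completion.denseRange_coe (α := WithAbs (baseAbv F v)))
  have hs : Function.Surjective (WithAbs.toAbs (baseAbv F v)) :=
    (WithAbs.equiv (baseAbv F v)).symm.surjective
  rwa [DenseRange, ← hs.range_comp] at h

instance (v : BasePlace F) : NontriviallyNormedField (kv v) where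
  non_trivial := by
    obtain ⟨b, π, hb, hπ, -⟩ := exists_uniformizer v
    exact ⟨algebraMap (k F) (kv v) π⁻¹, by rwa [norm_algebraMap_kv, map_inv₀, hπ, inv_inv]⟩

instance (v : BasePlace F) : IsUltrametricDist (kv v) := by
  refine IsUltrametricDist.isUltrametricDist_of_forall_norm_add_le_max_norm fun x y => ?_
  refine UniformSpace.Completion.induction_on₂ (p := fun x y : kv v => ‖x + y‖ ≤ max ‖x‖ ‖y‖) x y
    (isClosed_le (by fun_prop) (by fun_prop)) fun a b => ?_
  rw [← UniformSpace.Completion.coe_add, UniformSpace.Completion.norm_coe,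
    UniformSpace.Completion.norm_coe, UniformSpace.Completion.norm_coe]
  exact isNonarchimedean_baseAbv v a.ofAbs b.ofAbs

/-- A uniformizer of `k` at `v` is not a proper power in `k_v`. -/
theorem exists_not_pow_kv (v : BasePlace F) : ∃ a : k F,
    ∀ (m : ℕ) (z : kv v), z ^ m = algebraMap (k F) (kv v) a → m = 1 := by
  obtain ⟨b, π, hb, hπ, hval⟩ := exists_uniformizer v
  refine ⟨π, fun m z hz => ?_⟩
  have hb0 : 0 < b := by positivity
  have hnorm : ‖z‖ ^ m = b⁻¹ := by rw [← norm_pow, hz, norm_algebraMap_kv, hπ]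
  rcases eq_or_ne z 0 with rfl | hz0
  · rcases Nat.eq_zero_or_pos m with rfl | hm
    · rw [pow_zero] at hnorm
      exact absurd (inv_eq_one.1 hnorm.symm) hb.ne'
    · rw [norm_zero, zero_pow hm.ne'] at hnorm
      exact absurd hnorm (inv_pos.2 hb0).ne
  have hzpos : 0 < ‖z‖ := norm_pos_iff.2 hz0
  -- By the ultrametric inequality, an element of `k` close enough to `z` has the same norm, so
  -- `k_v` has no new values and `‖z‖` is an integral power of `b`.
  obtain ⟨y, hy⟩ := (denseRange_algebraMap_kv v).exists_dist_lt z hzpos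
  have hyz : ‖algebraMap (k F) (kv v) y‖ = ‖z‖ := by
    rw [dist_eq_norm] at hy
    have h := IsUltrametricDist.norm_eq_of_add_norm_lt_max (x := z)
      (y := -algebraMap (k F) (kv v) y)
      (by rw [← sub_eq_add_neg]; exact hy.trans_le (le_max_left _ _))
    rw [h, norm_neg]
  have hy0 : y ≠ 0 := by
    rintro rfl
    rw [map_zero, norm_zero] at hyz
    exact hzpos.ne hyz
  obtain ⟨n, hn⟩ := hval y hy0
  rw [norm_algebraMap_kv, hn] at hyz
  rw [← hyz, ← zpow_natCast, ← zpow_mul, ← zpow_neg_one] at hnorm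
  have h1 := zpow_right_injective₀ hb0 hb.ne' hnorm
  have h2 : (m : ℤ) ∣ 1 := ⟨-n, by linarith⟩
  exact_mod_cast Int.eq_one_of_dvd_one (by positivity) h2

end LocalFields

/-! ### Finite sums over fibres -/

section Finsum

/-- No finiteness of the support is needed: since the fibres are finite and nonempty, both supports
are infinite together, and both sums then default to `0`. -/
theorem finsum_comp_eq_finsum_card_fiber {α β : Type*} (f : α → β) (g : β → ℝ)
    [∀ b, Finite {a // f a = b}] [∀ b, Nonempty {a // f a = b}] :
    ∑ᶠ a, g (f a) = ∑ᶠ b, (Nat.card {a // f a = b} : ℝ) * g b := by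
  classical
  have hcard (b : β) : (Nat.card {a // f a = b} : ℝ) ≠ 0 := by
    exact_mod_cast Nat.card_pos.ne'
  have hsupp : (Function.support fun b => (Nat.card {a // f a = b} : ℝ) * g b) =
      Function.support g := by
    ext b
    simp [hcard b]
  have hsurj : Function.Surjective f := fun b =>
    let ⟨a⟩ := (inferInstance : Nonempty {a // f a = b})
    ⟨a.1, a.2⟩
  by_cases hfin : (Function.support g).Finite
  · have hpre : (f ⁻¹' Function.support g).Finite := by
      refine hfin.preimage' fun b _ => ?_
      exact Set.finite_coe_iff.1 (inferInstanceAs (Finite {a // f a = b}))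
    rw [finsum_eq_sum_of_support_subset (s := hpre.toFinset) _ (by intro a ha; simpa using ha),
      finsum_eq_sum_of_support_subset (s := hfin.toFinset) _ (by rw [hsupp]; simp),
      ← Finset.sum_fiberwise_of_maps_to (t := hfin.toFinset) (g := f)
        (by intro a ha; simpa using ha)]
    refine Finset.sum_congr rfl fun b hb => ?_
    rw [Finset.sum_congr rfl (g := fun _ => g b)
      (by intro a ha; rw [(Finset.mem_filter.1 ha).2]), Finset.sum_const, nsmul_eq_mul]
    congr 2
    refine (Nat.subtype_card _ fun a => ?_).symm
    simp only [Finset.mem_filter, Set.Finite.mem_toFinset, Set.mem_preimage]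
    exact ⟨fun h => h.2, fun h => ⟨by rw [h]; simpa using hb, h⟩⟩
  · rw [finsum_of_infinite_support, finsum_of_infinite_support]
    · rwa [hsupp]
    · intro h
      exact hfin ((h.image f).subset fun b hb => by
        obtain ⟨a, rfl⟩ := hsurj b
        exact ⟨a, hb, rfl⟩)

theorem finsum_sigma_eq {α : Type*} {β : α → Type*} [∀ a, Fintype (β a)] (f : (Σ a, β a) → ℝ)
    (hf : (Function.support f).Finite) : ∑ᶠ x, f x = ∑ᶠ a, ∑ b, f ⟨a, b⟩ := by
  classical
  let s : Finset α := hf.toFinset.image Sigma.fst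
  rw [finsum_eq_sum_of_support_subset (s := s.sigma fun _ => Finset.univ) f, Finset.sum_sigma,
    finsum_eq_sum_of_support_subset (s := s)]
  · intro a ha
    obtain ⟨b, -, hb⟩ := Finset.exists_ne_zero_of_sum_ne_zero ha
    exact Finset.mem_coe.2 (Finset.mem_image.2 ⟨⟨a, b⟩, by simpa using hb, rfl⟩)
  · intro x hx
    simp only [Finset.coe_sigma, Set.mem_sigma_iff, Finset.mem_coe, Finset.mem_univ, and_true]
    exact Finset.mem_image.2 ⟨x, by simpa using hx, rfl⟩

end Finsum

/-! ### Places and embeddings into the algebraic closures of the local fields -/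

section Embeddings

variable {F : Type*} [Field F] [Fintype F]

/-- The absolute value on an algebraic closure of `k_v`. -/
def abvCv (v : BasePlace F) : AbsoluteValue (Cv v) ℝ where
  toFun := spectralNorm (kv v) (Cv v)
  map_mul' x y := map_mul (spectralMulAlgNorm (kv v) (Cv v)) x y
  nonneg' x := apply_nonneg (spectralMulAlgNorm (kv v) (Cv v)) x
  eq_zero' _ := map_eq_zero_iff_eq_zero (spectralMulAlgNorm (kv v) (Cv v))
  add_le' x y := map_add_le_add (spectralMulAlgNorm (kv v) (Cv v)) x y

theorem abvCv_apply (v : BasePlace F) (x : Cv v) : abvCv v x = spectralNorm (kv v) (Cv v) x := rfl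

theorem abvCv_algebraMap (v : BasePlace F) (x : k F) :
    abvCv v (algebraMap (k F) (Cv v) x) = baseAbv F v x := by
  rw [abvCv_apply, IsScalarTower.algebraMap_apply (k F) (kv v) (Cv v), spectralNorm_extends,
    norm_algebraMap_kv]

theorem isNonarchimedean_abvCv (v : BasePlace F) : IsNonarchimedean (abvCv v) :=
  isNonarchimedean_spectralNorm

variable (L : Type*) [Field L] [Algebra (k F) L]

/-- Pairs of a place `v` of `k` and a `k`-embedding of `L` into the algebraic closure of `k_v`. -/
abbrev Embedding : Type _ := Σ v : BasePlace F, L →ₐ[k F] Cv v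

variable {L}

/-- The absolute value on `L` induced by an embedding. -/
def Embedding.abv (ω : Embedding (F := F) L) : AbsoluteValue L ℝ :=
  (abvCv ω.1).comp ω.2.toRingHom.injective

theorem Embedding.abv_apply (ω : Embedding (F := F) L) (x : L) : ω.abv x = abvCv ω.1 (ω.2 x) := rfl

theorem Embedding.isNonarchimedean_abv (ω : Embedding (F := F) L) : IsNonarchimedean ω.abv :=
  fun x y => by
    simpa only [Embedding.abv_apply, map_add] using isNonarchimedean_abvCv ω.1 (ω.2 x) (ω.2 y)

theorem Embedding.liesOver (ω : Embedding (F := F) L) : ω.abv.LiesOver (baseAbv F ω.1) :=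
  ⟨by
    ext x
    change abvCv ω.1 (ω.2 (algebraMap (k F) L x)) = _
    rw [AlgHom.commutes, abvCv_algebraMap]⟩

end Embeddings

/-! ### Local degrees as numbers of embeddings -/

section LocalDegrees

variable {F : Type*} [Field F] [Fintype F]

theorem norm_completionMap {K L : Type*} [Field K] [Field L] [Algebra K L]
    (v : AbsoluteValue K ℝ) (w : AbsoluteValue L ℝ) (h : w.LiesOver v) (x : v.Completion) :
    ‖completionMap v w h x‖ = ‖x‖ := by
  refine UniformSpace.Completion.induction_on x ?_ fun a => ?_
  · refine isClosed_eq ?_ continuous_norm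
    exact continuous_norm.comp UniformSpace.Completion.continuous_map
  · have h1 : completionMap v w h (a : v.Completion) = (withAbsMap v w a : WithAbs w) :=
      UniformSpace.Completion.mapRingHom_coe (continuous_withAbsMap v w h) a
    rw [h1, UniformSpace.Completion.norm_coe, UniformSpace.Completion.norm_coe]
    exact congrArg (fun u : AbsoluteValue K ℝ => u a.ofAbs) h.comp_eq

/-- The local degree at `w` is the number of embeddings inducing `w`, up to the (global)
inseparable degree. -/
theorem localDegree_eq {L : Type*} [Field L] [Algebra (k F) L] [FiniteDimensional (k F) L]
    (v : BasePlace F) (w : AbsoluteValue L ℝ) (h : w.LiesOver (baseAbv F v)) :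
    0 < Nat.card {σ : L →ₐ[k F] Cv v // ∀ x, abvCv v (σ x) = w x} ∧
    localDegree (baseAbv F v) w h =
      Field.finInsepDegree (k F) L * Nat.card {σ : L →ₐ[k F] Cv v // ∀ x, abvCv v (σ x) = w x} := by
  let alg : NormedAlgebra (kv v) w.Completion :=
    { (completionMap (baseAbv F v) w h).toAlgebra with
      norm_smul_le := fun a b => by
        change ‖completionMap (baseAbv F v) w h a * b‖ ≤ _
        rw [norm_mul, norm_completionMap] }
  have hdeg : localDegree (baseAbv F v) w h = Module.finrank (kv v) w.Completion := rfl
  have t1 : IsScalarTower (k F) (kv v) w.Completion := by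
    refine IsScalarTower.of_algebraMap_eq fun x => ?_
    exact (UniformSpace.Completion.mapRingHom_coe (continuous_withAbsMap (baseAbv F v) w h)
      (WithAbs.toAbs (baseAbv F v) x)).symm
  have t2 : IsScalarTower (k F) L w.Completion := IsScalarTower.of_algebraMap_eq fun x => rfl
  have hnorm (x : L) : ‖algebraMap L w.Completion x‖ = w x := by
    change ‖((WithAbs.toAbs w x : WithAbs w) : w.Completion)‖ = _
    rw [UniformSpace.Completion.norm_coe]
    rfl
  have hL : DenseRange (algebraMap L w.Completion) := by
    have h := (UniformSpace.Completion.denseRange_coe (α := WithAbs w))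
    have hs : Function.Surjective (WithAbs.toAbs w) := (WithAbs.equiv w).symm.surjective
    rwa [DenseRange, ← hs.range_comp] at h
  have hfin : FiniteDimensional (kv v) w.Completion := finiteDimensional_of_denseRange (k := k F) hL
  have hcard := card_isometric_embeddings (C := Cv v) (denseRange_algebraMap_kv v) hL
  simp only [hnorm] at hcard
  change Nat.card {σ : L →ₐ[k F] Cv v // ∀ x, abvCv v (σ x) = w x} = _ at hcard
  -- The separable part of `[L_w : k_v]` counts the embeddings inducing `w`. The inseparable part
  -- equals the global one, tested on a uniformizer.
  obtain ⟨a, ha⟩ := exists_not_pow_kv v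
  have hins := finInsepDegree_completion_eq (compositumMap_surjective hL) a ha
  rw [hcard, hdeg, ← hins, mul_comm, Field.finSepDegree_mul_finInsepDegree]
  exact ⟨Nat.pos_of_ne_zero (NeZero.ne _), rfl⟩

end LocalDegrees

/-! ### The height as a sum over embeddings -/

section HeightFormula

theorem const_mul_finsum {α : Type*} (c : ℝ) (f : α → ℝ) :
    c * ∑ᶠ a, f a = ∑ᶠ a, c * f a :=
  smul_finsum c f

variable {F : Type*} [Field F] [Fintype F]

/-- The place of `L` induced by an embedding. -/
def Embedding.toPlace {L : IntermediateField (k F) (kbar F)} (ω : Embedding (F := F) L) : Place L :=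
  ⟨ω.1, ω.abv, ω.liesOver⟩

/-- The embeddings inducing a given place. -/
def toPlaceFiberEquiv {L : IntermediateField (k F) (kbar F)} (w : Place L) :
    {ω : Embedding (F := F) L // ω.toPlace = w} ≃
      {σ : L →ₐ[k F] Cv w.1 // ∀ x, abvCv w.1 (σ x) = w.2.1 x} where
  toFun ω := ⟨(congrArg Sigma.fst ω.2 : ω.1.1 = w.1) ▸ ω.1.2, by
    obtain ⟨ω, rfl⟩ := ω
    exact fun x => rfl⟩
  invFun σ := ⟨⟨w.1, σ.1⟩, by
    have h : Embedding.abv (F := F) (L := L) ⟨w.1, σ.1⟩ = w.2.1 := AbsoluteValue.ext σ.2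
    exact Sigma.ext rfl (heq_of_eq (Subtype.ext h))⟩
  left_inv ω := by
    obtain ⟨ω, rfl⟩ := ω
    rfl
  right_inv σ := rfl

/-- Replacing each place by the embeddings that induce it absorbs `n_w` up to the constant factor
`[L:k]_i`, which cancels against `[L:k] = [L:k]_s [L:k]_i`. -/
theorem heightOver_eq_finsum (L : IntermediateField (k F) (kbar F)) [FiniteDimensional (k F) L]
    {ι : Type*} (x : ι → L) :
    heightOver L x = (1 / (Field.finSepDegree (k F) L : ℝ)) *
      ∑ᶠ ω : Embedding (F := F) L, ⨆ i, max 0 (Real.logb (Fintype.card F) (ω.abv (x i))) := by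
  let g (w : Place L) : ℝ := ⨆ i, max 0 (w.negVal (x i))
  have hcard (w : Place L) : 0 < Nat.card {ω : Embedding (F := F) L // ω.toPlace = w} ∧
      w.degree = Field.finInsepDegree (k F) L *
        Nat.card {ω : Embedding (F := F) L // ω.toPlace = w} := by
    rw [Nat.card_congr (toPlaceFiberEquiv w)]
    exact localDegree_eq w.1 w.2.1 w.2.2
  have hne (w : Place L) : Nonempty {ω : Embedding (F := F) L // ω.toPlace = w} :=
    (Nat.card_pos_iff.1 (hcard w).1).1
  have hfin (w : Place L) : Finite {ω : Embedding (F := F) L // ω.toPlace = w} :=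
    (Nat.card_pos_iff.1 (hcard w).1).2
  have h1 : ∑ᶠ w : Place L, (w.degree : ℝ) * g w =
      (Field.finInsepDegree (k F) L : ℝ) * ∑ᶠ ω : Embedding (F := F) L, g ω.toPlace := by
    rw [finsum_comp_eq_finsum_card_fiber, const_mul_finsum]
    refine finsum_congr fun w => ?_
    rw [(hcard w).2, Nat.cast_mul, mul_assoc]
  have h2 : (Module.finrank (k F) L : ℝ) =
      Field.finSepDegree (k F) L * Field.finInsepDegree (k F) L := by
    exact_mod_cast (Field.finSepDegree_mul_finInsepDegree (k F) L).symm
  have h3 : (Field.finInsepDegree (k F) L : ℝ) ≠ 0 := by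
    exact_mod_cast NeZero.ne (Field.finInsepDegree (k F) L)
  have h4 : (Field.finSepDegree (k F) L : ℝ) ≠ 0 := by
    exact_mod_cast NeZero.ne (Field.finSepDegree (k F) L)
  change 1 / (Module.finrank (k F) L : ℝ) * ∑ᶠ w : Place L, (w.degree : ℝ) * g w = _
  rw [h1, h2, ← mul_assoc]
  congr 1
  field_simp

/-- Restriction of embeddings to a subfield. -/
def Embedding.restrict {L K : Type*} [Field L] [Algebra (k F) L] [Field K] [Algebra (k F) K]
    (i : L →ₐ[k F] K) (ω : Embedding (F := F) K) : Embedding (F := F) L :=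
  ⟨ω.1, ω.2.comp i⟩

/-- Every embedding of `L` has exactly `[K:L]_s` extensions to `K`. This is what makes the height
independent of the field in which it is computed. -/
theorem finsum_restrict {L K : Type*} [Field L] [Algebra (k F) L] [Field K] [Algebra (k F) K]
    [FiniteDimensional (k F) K] (i : L →ₐ[k F] K) (g : Embedding (F := F) L → ℝ) :
    (1 / (Field.finSepDegree (k F) K : ℝ)) * ∑ᶠ ω : Embedding (F := F) K, g (ω.restrict i) =
      (1 / (Field.finSepDegree (k F) L : ℝ)) * ∑ᶠ ω, g ω := by
  let algLK : Algebra L K := i.toRingHom.toAlgebra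
  have tower : IsScalarTower (k F) L K := IsScalarTower.of_algebraMap_eq fun x => (i.commutes x).symm
  have : FiniteDimensional (k F) L := FiniteDimensional.of_injective i.toLinearMap i.injective
  have : FiniteDimensional L K := FiniteDimensional.right (k F) L K
  have hmul := Field.finSepDegree_mul_finSepDegree_of_isAlgebraic (k F) L K
  have hcard (τ : Embedding (F := F) L) :
      Nat.card {ω : Embedding (F := F) K // ω.restrict i = τ} = Field.finSepDegree L K := by
    let algC : Algebra L (Cv τ.1) := τ.2.toRingHom.toAlgebra
    rw [Field.finSepDegree_eq_of_isAlgClosed L K (Cv τ.1)]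
    have towerC : IsScalarTower (k F) L (Cv τ.1) :=
      IsScalarTower.of_algebraMap_eq fun x => (τ.2.commutes x).symm
    symm
    refine Nat.card_eq_of_bijective (fun φ : K →ₐ[L] Cv τ.1 =>
      (⟨⟨τ.1, φ.restrictScalars (k F)⟩, ?_⟩ :
        {ω : Embedding (F := F) K // ω.restrict i = τ})) ⟨fun φ ψ h => ?_, fun ω => ?_⟩
    · refine Sigma.ext rfl (heq_of_eq (AlgHom.ext fun x => ?_))
      exact φ.commutes x
    · have h1 := eq_of_heq (Sigma.ext_iff.1 (congrArg Subtype.val h)).2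
      exact AlgHom.ext fun x => DFunLike.congr_fun h1 x
    · obtain ⟨ω, rfl⟩ := ω
      exact ⟨{ ω.2 with commutes' := fun x => rfl }, rfl⟩
  have hpos : 0 < Field.finSepDegree L K := Nat.pos_of_ne_zero (NeZero.ne _)
  have hne (τ : Embedding (F := F) L) :
      Nonempty {ω : Embedding (F := F) K // ω.restrict i = τ} :=
    (Nat.card_pos_iff.1 ((hcard τ).symm ▸ hpos)).1
  have hfin (τ : Embedding (F := F) L) :
      Finite {ω : Embedding (F := F) K // ω.restrict i = τ} :=
    (Nat.card_pos_iff.1 ((hcard τ).symm ▸ hpos)).2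
  have h3 : (Field.finSepDegree L K : ℝ) ≠ 0 := by exact_mod_cast hpos.ne'
  rw [finsum_comp_eq_finsum_card_fiber]
  simp only [hcard]
  rw [← const_mul_finsum, ← hmul, ← mul_assoc]
  congr 1
  push_cast
  field_simp

theorem heightOver_eq_of_le {L K : IntermediateField (k F) (kbar F)} [FiniteDimensional (k F) K]
    (h : L ≤ K) {ι : Type*} (x : ι → L) :
    heightOver L x = (1 / (Field.finSepDegree (k F) K : ℝ)) *
      ∑ᶠ ω : Embedding (F := F) K,
        ⨆ i, max 0 (Real.logb (Fintype.card F) (ω.abv ⟨x i, h (x i).2⟩)) := by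
  have : FiniteDimensional (k F) L :=
    FiniteDimensional.of_injective (IntermediateField.inclusion h).toLinearMap
      (IntermediateField.inclusion h).injective
  rw [heightOver_eq_finsum, ← finsum_restrict (IntermediateField.inclusion h)]
  rfl

theorem height_eq {K : IntermediateField (k F) (kbar F)} [FiniteDimensional (k F) K] (x : K) :
    height (x : kbar F) = (1 / (Field.finSepDegree (k F) K : ℝ)) *
      ∑ᶠ ω : Embedding (F := F) K, max 0 (Real.logb (Fintype.card F) (ω.abv x)) := by
  have h : (k F)⟮(x : kbar F)⟯ ≤ K := by
    rw [IntermediateField.adjoin_simple_le_iff]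
    exact x.2
  rw [height, heightOver_eq_of_le h]
  simp only [ciSup_const]
  rfl

end HeightFormula

/-! ### Roots of minimal polynomials and embeddings -/

section Roots

/-- The roots of a minimal polynomial all have the same multiplicity, the inseparable degree. -/
theorem sum_aroots_minpoly {k R C : Type*} [Field k] [Field R] [Algebra k R] [Field C] [Algebra k C]
    [IsAlgClosed C] {y : R} (hy : IsIntegral k y) [Fintype (k⟮y⟯ →ₐ[k] C)] (f : C → ℝ) :
    (((minpoly k y).aroots C).map f).sum = (Field.finInsepDegree k k⟮y⟯ : ℝ) *
      ∑ σ : k⟮y⟯ →ₐ[k] C, f (σ (IntermediateField.AdjoinSimple.gen k y)) := by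
  classical
  obtain ⟨p, hp⟩ := ExpChar.exists k
  have hpC : ExpChar C p := expChar_of_injective_algebraMap (algebraMap k C).injective p
  -- The minimal polynomial is `g(X^{p^n})` with `g` separable, so its roots are the `p^n`-th roots
  -- of the roots of `g`, each with multiplicity `p^n`.
  obtain ⟨g, hg, n, hn⟩ := (minpoly.irreducible hy).hasSeparableContraction p
  have : FiniteDimensional k k⟮y⟯ := IntermediateField.adjoin.finiteDimensional hy
  obtain ⟨s, hs, hnodup⟩ : ∃ s : Multiset C, (minpoly k y).aroots C = p ^ n • s ∧ s.Nodup := by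
    refine ⟨(g.aroots C).map (iterateFrobeniusEquiv C p n).symm, ?_, ?_⟩
    · rw [aroots, ← hn, map_expand, roots_expand_pow]
    · exact (nodup_roots hg.map).map (iterateFrobeniusEquiv C p n).symm.injective
  have hp0 : p ^ n ≠ 0 := (pow_pos (expChar_pos k p) n).ne'
  have hsum (f : C → ℝ) : (((minpoly k y).aroots C).map f).sum = ((p ^ n : ℕ) : ℝ) *
      ∑ σ : k⟮y⟯ →ₐ[k] C, f (σ (IntermediateField.AdjoinSimple.gen k y)) := by
    have h1 : ∑ σ : k⟮y⟯ →ₐ[k] C, f (σ (IntermediateField.AdjoinSimple.gen k y)) =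
        ∑ r ∈ s.toFinset, f r := by
      refine Finset.sum_bij (fun σ _ => σ (IntermediateField.AdjoinSimple.gen k y))
        (fun σ _ => ?_) (fun σ _ τ _ h => ?_) (fun r hr => ?_) (fun _ _ => rfl)
      · have hmem : σ (IntermediateField.AdjoinSimple.gen k y) ∈ (minpoly k y).aroots C := by
          rw [mem_aroots]
          refine ⟨minpoly.ne_zero hy, ?_⟩
          rw [← IntermediateField.minpoly_gen, aeval_algHom_apply, minpoly.aeval, map_zero]
        rw [hs] at hmem
        exact Multiset.mem_toFinset.2 (Multiset.mem_of_mem_nsmul hmem)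
      · exact IntermediateField.algHom_ext_of_eq_adjoin _ rfl (by rintro x rfl; exact h)
      · have hmem : r ∈ (minpoly k y).aroots C := by
          rw [hs, Multiset.mem_nsmul]
          exact ⟨hp0, Multiset.mem_toFinset.1 hr⟩
        exact ⟨(IntermediateField.algHomAdjoinIntegralEquiv k hy).symm ⟨r, hmem⟩,
          Finset.mem_univ _, IntermediateField.algHomAdjoinIntegralEquiv_symm_apply_gen k hy _⟩
    rw [h1, hs, Multiset.map_nsmul, Multiset.sum_nsmul, nsmul_eq_mul,
      Finset.sum_multiset_map_count]
    congr 1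
    refine Finset.sum_congr rfl fun r hr => ?_
    rw [Multiset.count_eq_one_of_mem hnodup (Multiset.mem_toFinset.1 hr), one_smul]
  -- The constant function `1` compares degrees, `[k(y):k] = p^n [k(y):k]_s`, which identifies `p^n`
  -- as the inseparable degree.
  have hdeg := hsum fun _ => 1
  rw [Multiset.map_const', Multiset.sum_replicate, Finset.sum_const, nsmul_eq_mul, mul_one,
    nsmul_eq_mul, mul_one, Finset.card_univ, ← Nat.card_eq_fintype_card,
    ← Field.finSepDegree_eq_of_isAlgClosed k k⟮y⟯ C, aroots,
    ← (IsAlgClosed.splits _).natDegree_eq_card_roots, natDegree_map,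
    ← IntermediateField.adjoin.finrank hy, ← Field.finSepDegree_mul_finInsepDegree k k⟮y⟯] at hdeg
  have hins : Field.finInsepDegree k k⟮y⟯ = p ^ n := by
    have h2 : Field.finSepDegree k k⟮y⟯ * Field.finInsepDegree k k⟮y⟯ =
        p ^ n * Field.finSepDegree k k⟮y⟯ := by exact_mod_cast hdeg
    rw [mul_comm] at h2
    exact Nat.eq_of_mul_eq_mul_right (Nat.pos_of_ne_zero (NeZero.ne _)) h2
  rw [hsum, hins]

/-- The coefficients of a monic polynomial are bounded by the product of its large roots. -/
theorem abv_coeff_prod_X_sub_C_le {R : Type*} [CommRing R] [Nontrivial R] (w : AbsoluteValue R ℝ)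
    (hw : IsNonarchimedean w) (s : Multiset R) (j : ℕ) :
    w ((s.map fun r => X - C r).prod.coeff j) ≤ (s.map fun r => max 1 (w r)).prod := by
  have hone : w 1 ≤ 1 := by
    have h := map_mul w 1 1
    rw [mul_one] at h
    have h0 : w 1 ≠ 0 := w.ne_zero one_ne_zero
    exact ((mul_eq_left₀ h0).1 h.symm).le
  induction s using Multiset.induction_on generalizing j with
  | empty =>
    simp only [Multiset.map_zero, Multiset.prod_zero, coeff_one]
    split_ifs
    · exact hone
    · simp
  | cons a s ih =>
    have hP : 0 ≤ (s.map fun r => max 1 (w r)).prod := (w.nonneg _).trans (ih 0)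
    rw [Multiset.map_cons, Multiset.prod_cons, Multiset.map_cons, Multiset.prod_cons, sub_mul,
      coeff_sub, coeff_C_mul]
    have h1 : w ((X * (s.map fun r => X - C r).prod).coeff j) ≤
        (s.map fun r => max 1 (w r)).prod := by
      cases j with
      | zero => simpa using hP
      | succ j =>
        rw [coeff_X_mul]
        exact ih j
    have h2 : w (-(a * (s.map fun r => X - C r).prod.coeff j)) ≤
        w a * (s.map fun r => max 1 (w r)).prod := by
      rw [← neg_mul, map_mul]
      rw [AbsoluteValue.map_neg]
      exact mul_le_mul_of_nonneg_left (ih j) (w.nonneg _)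
    rw [sub_eq_add_neg]
    refine (hw _ _).trans (max_le (h1.trans ?_) (h2.trans ?_))
    · exact le_mul_of_one_le_left hP (le_max_left _ _)
    · exact mul_le_mul_of_nonneg_right (le_max_right _ _) hP

theorem logb_prod_max_one {R : Type*} {b : ℝ} (hb : 1 < b) (w : R → ℝ) (hw : ∀ r, 0 ≤ w r)
    (s : Multiset R) :
    Real.logb b (s.map fun r => max 1 (w r)).prod = (s.map fun r => max 0 (Real.logb b (w r))).sum ∧
      0 < (s.map fun r => max 1 (w r)).prod := by
  induction s using Multiset.induction_on with
  | empty => simp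
  | cons a s ih =>
    have h1 : 0 < max 1 (w a) := lt_max_of_lt_left one_pos
    rw [Multiset.map_cons, Multiset.prod_cons, Multiset.map_cons, Multiset.sum_cons,
      Real.logb_mul h1.ne' ih.2.ne', ih.1]
    refine ⟨?_, mul_pos h1 ih.2⟩
    congr 1
    rcases le_total (w a) 1 with h | h
    · rw [max_eq_left h, Real.logb_one, max_eq_left (Real.logb_nonpos hb (hw a) h)]
    · rw [max_eq_right h, max_eq_right (Real.logb_nonneg hb h)]

end Roots

/-! ### Finiteness and the product formula in finite extensions of `k` -/

section ProductFormula

variable {F : Type*} [Field F] [Fintype F]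

theorem one_lt_card_real : (1 : ℝ) < Fintype.card F := by exact_mod_cast one_lt_card F

theorem finite_one_lt_baseAbv (a : k F) : {v | 1 < baseAbv F v a}.Finite := by
  rcases eq_or_ne a 0 with rfl | ha
  · refine Set.finite_empty.subset fun v hv => ?_
    rw [Set.mem_ofPred_eq, map_zero] at hv
    exact absurd hv (not_lt.2 zero_le_one)
  · exact (finite_and_productFormula ha).1.subset fun v hv => ne_of_gt hv

theorem abvCv_le_one_of_aeval_eq_zero {v : BasePlace F} {P : (k F)[X]} (hP : P.Monic)
    (hcoeff : ∀ n, baseAbv F v (P.coeff n) ≤ 1) {r : Cv v} (hr : aeval r P = 0) :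
    abvCv v r ≤ 1 := by
  have h := norm_root_le_spectralValue (f := spectralAlgNorm (kv v) (Cv v))
    spectralAlgNorm_isPowMul isNonarchimedean_spectralNorm
    (p := P.map (algebraMap (k F) (kv v))) (hP.map _) (x := r)
    (by rwa [aeval_map_algebraMap])
  refine h.trans ((spectralValue_le_one_iff (hP.map _)).2 fun n => ?_)
  rw [coeff_map, norm_algebraMap_kv]
  exact hcoeff n

variable {K : Type*} [Field K] [Algebra (k F) K] [FiniteDimensional (k F) K]

/-- An absolute value of `y` can exceed `1` only above a place where some coefficient of its minimal
polynomial does. There are finitely many such places, each with finitely many embeddings. -/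
theorem finite_one_lt_abv (y : K) : {ω : Embedding (F := F) K | 1 < ω.abv y}.Finite := by
  have hy : IsIntegral (k F) y := Algebra.IsIntegral.isIntegral y
  have hfin : (⋃ n ∈ Finset.range ((minpoly (k F) y).natDegree + 1),
      {v | 1 < baseAbv F v ((minpoly (k F) y).coeff n)}).Finite :=
    Set.Finite.biUnion (Finset.finite_toSet _) fun n _ => finite_one_lt_baseAbv _
  refine (hfin.preimage' (f := Sigma.fst) (α := Embedding (F := F) K) fun v _ => ?_).subset ?_
  · refine (Set.finite_range (fun σ : K →ₐ[k F] Cv v => (⟨v, σ⟩ : Embedding (F := F) K))).subset ?_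
    rintro ⟨v', σ⟩ rfl
    exact ⟨σ, rfl⟩
  · intro ω hω
    by_contra h
    simp only [Set.mem_preimage, Set.mem_iUnion, not_exists, Set.mem_ofPred_eq, not_lt,
      Finset.mem_range] at h
    refine (not_le.2 hω) (abvCv_le_one_of_aeval_eq_zero (minpoly.monic hy) (fun n => ?_)
      (r := ω.2 y) ?_)
    · rcases lt_or_ge n ((minpoly (k F) y).natDegree + 1) with hn | hn
      · exact h n hn
      · rw [coeff_eq_zero_of_natDegree_lt (by omega)]
        simp
    · rw [aeval_algHom_apply, minpoly.aeval, map_zero]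

theorem finite_support_posLog (y : K) : (Function.support fun ω : Embedding (F := F) K =>
    max 0 (Real.logb (Fintype.card F) (ω.abv y))).Finite := by
  refine (finite_one_lt_abv y).subset fun ω hω => ?_
  by_contra h
  exact hω (max_eq_left (Real.logb_nonpos one_lt_card_real (ω.abv.nonneg _) (not_lt.1 h)))

theorem finite_support_logb (y : K) : (Function.support fun ω : Embedding (F := F) K =>
    Real.logb (Fintype.card F) (ω.abv y)).Finite := by
  refine ((finite_one_lt_abv y).union (finite_one_lt_abv y⁻¹)).subset fun ω hω => ?_
  by_contra h
  simp only [Set.mem_union, Set.mem_ofPred_eq, not_or, not_lt, map_inv₀] at h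
  rcases eq_or_ne y 0 with rfl | hy
  · exact hω (by simp)
  have hpos : 0 < ω.abv y := ω.abv.pos hy
  have h1 : ω.abv y = 1 := le_antisymm h.1 ((inv_le_one₀ hpos).1 h.2)
  exact hω (by simp [h1])

theorem finsum_adjoin_eq {R : Type*} [Field R] [Algebra (k F) R] {y : R}
    (hy : IsIntegral (k F) y) (g : ∀ v : BasePlace F, Cv v → ℝ)
    (hg : (Function.support fun ω : Embedding (F := F) (k F)⟮y⟯ =>
      g ω.1 (ω.2 (IntermediateField.AdjoinSimple.gen (k F) y))).Finite) :
    (Field.finInsepDegree (k F) (k F)⟮y⟯ : ℝ) * ∑ᶠ ω : Embedding (F := F) (k F)⟮y⟯,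
        g ω.1 (ω.2 (IntermediateField.AdjoinSimple.gen (k F) y)) =
      ∑ᶠ v : BasePlace F, (((minpoly (k F) y).aroots (Cv v)).map (g v)).sum := by
  have : FiniteDimensional (k F) (k F)⟮y⟯ := IntermediateField.adjoin.finiteDimensional hy
  let _ (v : BasePlace F) : Fintype ((k F)⟮y⟯ →ₐ[k F] Cv v) := Fintype.ofFinite _
  rw [finsum_sigma_eq _ hg, const_mul_finsum]
  refine finsum_congr fun v => ?_
  rw [sum_aroots_minpoly hy]

/-- After descent to `k(y)`, the sum at `v` runs over the roots of the minimal polynomial, whose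
product is its constant term up to sign. The product formula of `k` for this constant term
concludes. -/
theorem productFormula {y : K} (hy0 : y ≠ 0) :
    ∑ᶠ ω : Embedding (F := F) K, Real.logb (Fintype.card F) (ω.abv y) = 0 := by
  have hy : IsIntegral (k F) y := Algebra.IsIntegral.isIntegral y
  have hK : (Field.finSepDegree (k F) K : ℝ) ≠ 0 := by
    exact_mod_cast NeZero.ne (Field.finSepDegree (k F) K)
  have hI : (Field.finInsepDegree (k F) (k F)⟮y⟯ : ℝ) ≠ 0 := by
    exact_mod_cast NeZero.ne (Field.finInsepDegree (k F) (k F)⟮y⟯)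
  have h1 := finsum_restrict ((k F)⟮y⟯.val) (fun ω : Embedding (F := F) (k F)⟮y⟯ =>
    Real.logb (Fintype.card F) (ω.abv (IntermediateField.AdjoinSimple.gen (k F) y)))
  have h2 := finsum_adjoin_eq hy (fun v r => Real.logb (Fintype.card F) (abvCv v r))
    (finite_support_logb _)
  have hc0 : (minpoly (k F) y).coeff 0 ≠ 0 := minpoly.coeff_zero_ne_zero hy hy0
  have h3 (v : BasePlace F) : (((minpoly (k F) y).aroots (Cv v)).map
      fun r => Real.logb (Fintype.card F) (abvCv v r)).sum =
        Real.logb (Fintype.card F) (baseAbv F v ((minpoly (k F) y).coeff 0)) := by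
    have hsplit : ((minpoly (k F) y).map (algebraMap (k F) (Cv v))).Splits := IsAlgClosed.splits _
    have hprod := hsplit.coeff_zero_eq_prod_roots_of_monic ((minpoly.monic hy).map _)
    rw [coeff_map] at hprod
    have hlog (s : Multiset (Cv v)) (hs : (0 : Cv v) ∉ s) :
        (s.map fun r => Real.logb (Fintype.card F) (abvCv v r)).sum =
          Real.logb (Fintype.card F) (abvCv v s.prod) := by
      induction s using Multiset.induction_on with
      | empty => simp
      | cons a s ih =>
        simp only [Multiset.mem_cons, not_or] at hs
        rw [Multiset.map_cons, Multiset.sum_cons, Multiset.prod_cons, map_mul, Real.logb_mul, ih hs.2]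
        · exact (_root_.map_ne_zero _).2 (Ne.symm hs.1)
        · exact (_root_.map_ne_zero _).2 (Multiset.prod_ne_zero hs.2)
    rw [hlog, ← abvCv_algebraMap, hprod, map_mul, map_pow, AbsoluteValue.map_neg, map_one, one_pow,
      one_mul]
    · intro h0
      rw [mem_aroots] at h0
      have h4 := h0.2
      rw [aeval_def, eval₂_at_zero] at h4
      exact hc0 ((map_eq_zero _).1 h4)
  simp only [h3, (finite_and_productFormula hc0).2] at h2
  have h5 := (mul_eq_zero.1 h2).resolve_left hI
  have h6 : ∑ᶠ ω : Embedding (F := F) (k F)⟮y⟯,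
    Real.logb (Fintype.card F) (ω.abv (IntermediateField.AdjoinSimple.gen (k F) y)) = 0 := h5
  rw [h6, mul_zero] at h1
  exact (mul_eq_zero.1 h1).resolve_left (one_div_ne_zero hK)

end ProductFormula

/-! ### Counting points of bounded degree and height -/

section Northcott

variable {F : Type*} [Field F] [Fintype F]

/-- The right side is a sum of local logarithmic Mahler measures of the minimal polynomial. The
multiplicity of its roots supplies the factor `[k(y):k]_i` that turns `[k(y):k]_s` into the degree.
-/
theorem natDegree_mul_height (y : kbar F) :
    ((minpoly (k F) y).natDegree : ℝ) * height y = ∑ᶠ v : BasePlace F,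
      (((minpoly (k F) y).aroots (Cv v)).map
        fun r => max 0 (Real.logb (Fintype.card F) (abvCv v r))).sum := by
  have hy : IsIntegral (k F) y := Algebra.IsIntegral.isIntegral y
  have : FiniteDimensional (k F) (k F)⟮y⟯ := IntermediateField.adjoin.finiteDimensional hy
  have hS : (Field.finSepDegree (k F) (k F)⟮y⟯ : ℝ) ≠ 0 := by
    exact_mod_cast NeZero.ne (Field.finSepDegree (k F) (k F)⟮y⟯)
  have h2 := finsum_adjoin_eq hy (fun v r => max 0 (Real.logb (Fintype.card F) (abvCv v r)))
    (finite_support_posLog _)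
  have h1 := height_eq (IntermediateField.AdjoinSimple.gen (k F) y)
  rw [IntermediateField.AdjoinSimple.coe_gen] at h1
  rw [h1, ← IntermediateField.adjoin.finrank hy,
    ← Field.finSepDegree_mul_finInsepDegree (k F) (k F)⟮y⟯, ← h2]
  push_cast
  field_simp
  rfl

theorem finite_support_sum_aroots (y : kbar F) : (Function.support fun v : BasePlace F =>
    (((minpoly (k F) y).aroots (Cv v)).map
      fun r => max 0 (Real.logb (Fintype.card F) (abvCv v r))).sum).Finite := by
  have hy : IsIntegral (k F) y := Algebra.IsIntegral.isIntegral y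
  have : FiniteDimensional (k F) (k F)⟮y⟯ := IntermediateField.adjoin.finiteDimensional hy
  let _ (v : BasePlace F) : Fintype ((k F)⟮y⟯ →ₐ[k F] Cv v) := Fintype.ofFinite _
  refine ((finite_support_posLog (IntermediateField.AdjoinSimple.gen (k F) y)).image
    Sigma.fst).subset fun v hv => ?_
  rw [Function.mem_support, sum_aroots_minpoly hy] at hv
  obtain ⟨σ, -, hσ⟩ := Finset.exists_ne_zero_of_sum_ne_zero (right_ne_zero_of_mul hv)
  exact ⟨⟨v, σ⟩, hσ, rfl⟩

theorem logb_coeff_minpoly_le (y : kbar F) (v : BasePlace F) (j : ℕ)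
    (hj : (minpoly (k F) y).coeff j ≠ 0) :
    Real.logb (Fintype.card F) (baseAbv F v ((minpoly (k F) y).coeff j)) ≤
      (((minpoly (k F) y).aroots (Cv v)).map
        fun r => max 0 (Real.logb (Fintype.card F) (abvCv v r))).sum := by
  have hy : IsIntegral (k F) y := Algebra.IsIntegral.isIntegral y
  have hsplit : ((minpoly (k F) y).map (algebraMap (k F) (Cv v))).Splits := IsAlgClosed.splits _
  have hprod := hsplit.eq_prod_roots_of_monic ((minpoly.monic hy).map _)
  have hle := abv_coeff_prod_X_sub_C_le (abvCv v) (isNonarchimedean_abvCv v)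
    ((minpoly (k F) y).aroots (Cv v)) j
  rw [aroots, ← hprod, coeff_map, abvCv_algebraMap] at hle
  obtain ⟨hlog, hpos⟩ := logb_prod_max_one (one_lt_card_real (F := F)) (abvCv v)
    (abvCv v).nonneg ((minpoly (k F) y).aroots (Cv v))
  rw [← hlog]
  exact Real.logb_le_logb_of_le one_lt_card_real ((baseAbv F v).pos hj) hle

/-- A nonzero polynomial over `F[X]` proportional to a given monic polynomial over `k`, without
common factor of the coefficients. -/
theorem exists_isPrimitive_map_eq {F : Type*} [Field F] (m : (k F)[X]) (hm : m.Monic) : ∃ (P : F[X][X]) (c : k F),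
    P.IsPrimitive ∧ c ≠ 0 ∧ P.map (algebraMap F[X] (k F)) = C c * m := by
  obtain ⟨_⟩ := (inferInstance : Nonempty (NormalizedGCDMonoid F[X]))
  obtain ⟨b, hbM, hb⟩ := IsLocalization.integerNormalization_spec (nonZeroDivisors F[X]) m
  set Q := IsLocalization.integerNormalization (nonZeroDivisors F[X]) m with hQ
  have hinj : Function.Injective (algebraMap F[X] (k F)) := IsFractionRing.injective F[X] (k F)
  have hb0 : algebraMap F[X] (k F) b ≠ 0 :=
    (map_ne_zero_iff _ hinj).2 (nonZeroDivisors.ne_zero hbM)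
  have hb' : Q.map (algebraMap F[X] (k F)) = C (algebraMap F[X] (k F) b) * m := by
    rw [hb, ← smul_eq_C_mul, algebraMap_smul]
  have hQ0 : Q ≠ 0 := by
    intro h
    rw [h, Polynomial.map_zero] at hb'
    exact mul_ne_zero (C_ne_zero.2 hb0) hm.ne_zero hb'.symm
  have hc0 : algebraMap F[X] (k F) Q.content ≠ 0 :=
    (map_ne_zero_iff _ hinj).2 (by rwa [Ne, content_eq_zero_iff])
  refine ⟨Q.primPart, (algebraMap F[X] (k F) Q.content)⁻¹ * algebraMap F[X] (k F) b,
    Q.isPrimitive_primPart, mul_ne_zero (inv_ne_zero hc0) hb0, ?_⟩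
  have hQmap : Q.map (algebraMap F[X] (k F)) =
      C (algebraMap F[X] (k F) Q.content) * Q.primPart.map (algebraMap F[X] (k F)) := by
    conv_lhs => rw [Q.eq_C_content_mul_primPart]
    rw [Polynomial.map_mul, map_C]
  rw [C_mul, mul_assoc, ← hb', hQmap, ← mul_assoc, ← C_mul, inv_mul_cancel₀ hc0, C_1, one_mul]

/-- A point of `k̄` is a root of a polynomial over `F[X]` of the same degree, whose coefficients
have degree bounded in terms of the height. -/
theorem exists_polynomial_of_height (y : kbar F) : ∃ P : F[X][X], P ≠ 0 ∧
    P.natDegree = (minpoly (k F) y).natDegree ∧ aeval y P = 0 ∧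
    ∀ j, ((P.coeff j).natDegree : ℝ) ≤ (minpoly (k F) y).natDegree * height y := by
  have hy : IsIntegral (k F) y := Algebra.IsIntegral.isIntegral y
  obtain ⟨P, c, hprim, hc, hP⟩ := exists_isPrimitive_map_eq _ (minpoly.monic hy)
  have hinj : Function.Injective (algebraMap F[X] (k F)) := IsFractionRing.injective F[X] (k F)
  have hcoeff (j : ℕ) : algebraMap F[X] (k F) (P.coeff j) = c * (minpoly (k F) y).coeff j := by
    rw [← coeff_map, hP, coeff_C_mul]
  have hne (j : ℕ) : P.coeff j ≠ 0 ↔ (minpoly (k F) y).coeff j ≠ 0 := by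
    rw [← map_ne_zero_iff _ hinj, hcoeff, mul_ne_zero_iff]
    exact ⟨fun h => h.2, fun h => ⟨hc, h⟩⟩
  have hP0 : P ≠ 0 := hprim.ne_zero
  let H (v : BasePlace F) : ℝ := (((minpoly (k F) y).aroots (Cv v)).map
        fun r => max 0 (Real.logb (Fintype.card F) (abvCv v r))).sum
  have hbound (v : BasePlace F) (j : ℕ) (hj : P.coeff j ≠ 0) :
      Real.logb (Fintype.card F) (baseAbv F v (algebraMap F[X] (k F) (P.coeff j))) ≤
        H v + Real.logb (Fintype.card F) (baseAbv F v c) := by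
    rw [hcoeff, map_mul, Real.logb_mul ((_root_.map_ne_zero _).2 hc)
      ((_root_.map_ne_zero _).2 ((hne j).1 hj)), add_comm]
    gcongr
    exact logb_coeff_minpoly_le y v j ((hne j).1 hj)
  have hinfty (j : ℕ) (hj : P.coeff j ≠ 0) :
      ((P.coeff j).natDegree : ℝ) ≤ H none + Real.logb (Fintype.card F) (baseAbv F none c) := by
    have h := hbound none j hj
    rwa [inftyAbv_polynomial hj, logb_card_pow] at h
  -- Primitivity provides, at each finite place, a coefficient of absolute value `1`, so every local
  -- term is nonnegative. Their sum is `deg · h(y)` by the product formula for `c`, so the term at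
  -- infinity, which bounds the `T`-degrees, is at most that.
  have hnonneg (v : BasePlace F) : 0 ≤ H v + Real.logb (Fintype.card F) (baseAbv F v c) := by
    cases v with
    | none =>
      exact (Nat.cast_nonneg _).trans (hinfty P.natDegree (leadingCoeff_ne_zero.2 hP0))
    | some l =>
      have hl : ∃ j, ¬ l.1 ∣ P.coeff j := by
        by_contra! h
        exact l.2.2.not_isUnit (hprim _ ((C_dvd_iff_dvd_coeff _ _).2 h))
      obtain ⟨j, hj⟩ := hl
      have hj0 : P.coeff j ≠ 0 := fun h => hj (h ▸ dvd_zero _)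
      have h := hbound (some l) j hj0
      rwa [(baseAbv_some_polynomial_eq_one_iff l _).2 hj, Real.logb_one] at h
  have hfin1 : (Function.support H).Finite := finite_support_sum_aroots y
  have hfin2 : (Function.support fun v => Real.logb (Fintype.card F) (baseAbv F v c)).Finite :=
    (finite_and_productFormula hc).1.subset fun v hv h1 => hv (by simp [h1])
  have hsum : ∑ᶠ v, (H v + Real.logb (Fintype.card F) (baseAbv F v c)) =
      (minpoly (k F) y).natDegree * height y := by
    rw [finsum_add_distrib hfin1 hfin2, (finite_and_productFormula hc).2, add_zero,
      natDegree_mul_height]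
  have hmax : H none + Real.logb (Fintype.card F) (baseAbv F none c) ≤
      (minpoly (k F) y).natDegree * height y := by
    rw [← hsum]
    exact single_le_finsum none
      ((hfin1.union hfin2).subset (Function.support_add _ _)) hnonneg
  refine ⟨P, hP0, ?_, ?_, fun j => ?_⟩
  · rw [← natDegree_map_eq_of_injective hinj, hP, natDegree_C_mul hc]
  · rw [← aeval_map_algebraMap (k F), hP, map_mul, minpoly.aeval, mul_zero]
  · by_cases hj : P.coeff j = 0
    · rw [hj, natDegree_zero, Nat.cast_zero]
      exact (hnonneg none).trans hmax
    · exact (hinfty j hj).trans hmax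

/-- Each point is a root of a polynomial over `A` described by an `(n+1) × (B+1)` array of elements
of `F`, and each array accounts for at most `n` points. -/
theorem card_le_of_height_le (n B : ℕ) (S : Finset (kbar F))
    (hdeg : ∀ y ∈ S, (minpoly (k F) y).natDegree ≤ n)
    (hS : ∀ y ∈ S, (minpoly (k F) y).natDegree * height y < B + 1) :
    S.card ≤ n * Fintype.card F ^ ((B + 1) * (n + 1)) := by
  classical
  choose P hP0 hPdeg hPy hPcoeff using exists_polynomial_of_height (F := F)
  let code (y : kbar F) : Fin (n + 1) → Fin (B + 1) → F := fun i j => ((P y).coeff i).coeff j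
  have hcoeff {y : kbar F} (hy : y ∈ S) (i : ℕ) : ((P y).coeff i).natDegree ≤ B := by
    have h : (((P y).coeff i).natDegree : ℝ) < B + 1 := (hPcoeff y i).trans_lt (hS y hy)
    have h' : ((P y).coeff i).natDegree < B + 1 := by exact_mod_cast h
    omega
  have hcode {y z : kbar F} (hy : y ∈ S) (hz : z ∈ S) (h : code y = code z) : P y = P z := by
    ext i j
    by_cases hi : i < n + 1
    · by_cases hj : j < B + 1
      · exact congrFun (congrFun h ⟨i, hi⟩) ⟨j, hj⟩
      · rw [coeff_eq_zero_of_natDegree_lt (by have := hcoeff hy i; omega),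
          coeff_eq_zero_of_natDegree_lt (by have := hcoeff hz i; omega)]
    · rw [coeff_eq_zero_of_natDegree_lt (p := P y) (by have := hdeg y hy; rw [hPdeg]; omega),
        coeff_eq_zero_of_natDegree_lt (p := P z) (by have := hdeg z hz; rw [hPdeg]; omega)]
  have hinj : Function.Injective (algebraMap F[X] (kbar F)) := by
    rw [IsScalarTower.algebraMap_eq F[X] (k F) (kbar F)]
    exact (algebraMap (k F) (kbar F)).injective.comp (IsFractionRing.injective F[X] (k F))
  have hfib : ∀ b ∈ S.image code, (S.filter fun y => code y = b).card ≤ n := by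
    intro b hb
    obtain ⟨z, hz, rfl⟩ := Finset.mem_image.1 hb
    have hmap0 : (P z).map (algebraMap F[X] (kbar F)) ≠ 0 :=
      (Polynomial.map_ne_zero_iff hinj).2 (hP0 z)
    calc (S.filter fun y => code y = code z).card
        ≤ ((P z).map (algebraMap F[X] (kbar F))).roots.toFinset.card := by
          refine Finset.card_le_card fun y hy => ?_
          obtain ⟨hyS, hyz⟩ := Finset.mem_filter.1 hy
          rw [Multiset.mem_toFinset, mem_roots hmap0, IsRoot.def, eval_map_algebraMap,
            ← hcode hyS hz hyz]
          exact hPy y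
      _ ≤ _ := Multiset.toFinset_card_le _
      _ ≤ _ := card_roots' _
      _ ≤ (P z).natDegree := natDegree_map_le
      _ ≤ n := by
        rw [hPdeg]
        exact hdeg z hz
  calc S.card ≤ n * (S.image code).card := Finset.card_le_mul_card_image S n hfib
    _ ≤ n * Fintype.card (Fin (n + 1) → Fin (B + 1) → F) := by
      gcongr
      exact Finset.card_le_univ _
    _ = n * Fintype.card F ^ ((B + 1) * (n + 1)) := by
      simp [pow_mul]

end Northcott

/-! ### Local estimates -/

section LocalEstimates

variable {K : Type*} [Field K] {b : ℝ} {w : AbsoluteValue K ℝ}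

/-- The condition `0 ≤ s` keeps this valid at `z = 0`, where `Real.logb` takes the default value
`0`. -/
theorem posLog_le_iff (hb : 1 < b) (z : K) {s : ℝ} (hs : 0 ≤ s) :
    max 0 (Real.logb b (w z)) ≤ s ↔ w z ≤ b ^ s := by
  rw [max_le_iff, and_iff_right hs]
  rcases eq_or_ne z 0 with rfl | hz
  · simp only [map_zero, Real.logb_zero, hs, true_iff]
    positivity
  · rw [Real.logb_le_iff_le_rpow hb (w.pos hz)]

theorem posLog_add_le (hb : 1 < b) (hw : IsNonarchimedean w) (y z : K) :
    max 0 (Real.logb b (w (y + z))) ≤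
      max 0 (Real.logb b (w y)) + max 0 (Real.logb b (w z)) := by
  have hy : 0 ≤ max 0 (Real.logb b (w y)) := le_max_left _ _
  have hz : 0 ≤ max 0 (Real.logb b (w z)) := le_max_left _ _
  rw [posLog_le_iff hb _ (add_nonneg hy hz)]
  refine (hw y z).trans (max_le ?_ ?_)
  · exact (posLog_le_iff hb y (add_nonneg hy hz)).1 (le_add_of_nonneg_right hz)
  · exact (posLog_le_iff hb z (add_nonneg hy hz)).1 (le_add_of_nonneg_left hy)

variable {q d : ℕ}

theorem posLog_sum_pow_le (hb : 1 < b) (hw : IsNonarchimedean w) (hq : 1 ≤ q)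
    (a : Fin (d + 1) → K) (y : K) :
    max 0 (Real.logb b (w (∑ i, a i * y ^ q ^ (i : ℕ)))) ≤
      (q : ℝ) ^ d * max 0 (Real.logb b (w y)) + ⨆ i, max 0 (Real.logb b (w (a i))) := by
  set s := ⨆ i, max 0 (Real.logb b (w (a i))) with hs
  set t := max 0 (Real.logb b (w y)) with ht
  have ht0 : 0 ≤ t := le_max_left _ _
  have hbdd : BddAbove (Set.range fun i => max 0 (Real.logb b (w (a i)))) :=
    (Set.finite_range _).bddAbove
  have hle (i : Fin (d + 1)) : max 0 (Real.logb b (w (a i))) ≤ s := le_ciSup hbdd i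
  have hs0 : 0 ≤ s := (le_max_left _ _).trans (hle 0)
  have hb0 : 0 < b := by positivity
  rw [posLog_le_iff hb _ (by positivity)]
  obtain ⟨i, -, hi⟩ := hw.finset_image_add_of_nonempty (fun i : Fin (d + 1) => a i * y ^ q ^ (i : ℕ))
    (Finset.univ_nonempty)
  refine hi.trans ?_
  rw [map_mul, map_pow, Real.rpow_add hb0, mul_comm]
  have h1 : w (a i) ≤ b ^ s := (posLog_le_iff hb _ hs0).1 (hle i)
  have h2 : w y ≤ b ^ t := (posLog_le_iff hb _ ht0).1 le_rfl
  have h3 : w y ^ q ^ (i : ℕ) ≤ b ^ ((q : ℝ) ^ d * t) := by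
    calc w y ^ q ^ (i : ℕ) ≤ (b ^ t) ^ q ^ (i : ℕ) := by gcongr
      _ ≤ (b ^ t) ^ q ^ d := by
        refine pow_le_pow_right₀ (Real.one_le_rpow hb.le ht0) ?_
        exact Nat.pow_le_pow_right hq (Nat.lt_succ_iff.1 i.2)
      _ = b ^ ((q : ℝ) ^ d * t) := by
        rw [← Real.rpow_natCast, ← Real.rpow_mul hb0.le, mul_comm]
        norm_cast
  exact mul_le_mul h3 h1 (w.nonneg _) (by positivity)

/-- With `t = log |y|`, only the case `q^d t > 2(s + u)` needs an argument. Since `2 q^i ≤ q^d` for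
`i < d`, the lower terms have logarithm at most `s + q^d t / 2 < q^d t - u`, so the leading term
strictly dominates, and its coefficient costs at most `u`. -/
theorem posLog_sum_pow_ge (hb : 1 < b) (hw : IsNonarchimedean w) (hq : 2 ≤ q) (hd : 0 < d)
    (a : Fin (d + 1) → K) (ha : a (Fin.last d) ≠ 0) (y : K) :
    (q : ℝ) ^ d * max 0 (Real.logb b (w y)) ≤
      max 0 (Real.logb b (w (∑ i, a i * y ^ q ^ (i : ℕ)))) +
        2 * ((⨆ i, max 0 (Real.logb b (w (a i)))) +
          max 0 (Real.logb b (w (a (Fin.last d))⁻¹))) := by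
  set s := ⨆ i, max 0 (Real.logb b (w (a i))) with hs
  set u := max 0 (Real.logb b (w (a (Fin.last d))⁻¹)) with hu
  set t := Real.logb b (w y) with ht
  have hu0 : 0 ≤ u := le_max_left _ _
  have hbdd : BddAbove (Set.range fun i => max 0 (Real.logb b (w (a i)))) :=
    (Set.finite_range _).bddAbove
  have hle (i : Fin (d + 1)) : max 0 (Real.logb b (w (a i))) ≤ s := le_ciSup hbdd i
  have hs0 : 0 ≤ s := (le_max_left _ _).trans (hle 0)
  have hr0 : 0 ≤ max 0 (Real.logb b (w (∑ i, a i * y ^ q ^ (i : ℕ)))) := le_max_left _ _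
  have hq0 : (0 : ℝ) < q := by positivity
  rcases le_or_gt t 0 with ht0 | ht0
  · rw [max_eq_left ht0, mul_zero]
    positivity
  rw [max_eq_right ht0.le]
  rcases le_or_gt ((q : ℝ) ^ d * t) (2 * (s + u)) with hsmall | hlarge
  · exact hsmall.trans (le_add_of_nonneg_left hr0)
  have hy : y ≠ 0 := by
    rintro rfl
    simp [ht] at ht0
  have hal : Real.logb b (w (a (Fin.last d))) = -Real.logb b (w (a (Fin.last d))⁻¹) := by
    rw [map_inv₀, Real.logb_inv, neg_neg]
  have hlast : Real.logb b (w (a (Fin.last d) * y ^ q ^ d)) =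
      Real.logb b (w (a (Fin.last d))) + (q : ℝ) ^ d * t := by
    rw [map_mul, map_pow, Real.logb_mul ((_root_.map_ne_zero _).2 ha)
      (pow_ne_zero _ ((_root_.map_ne_zero _).2 hy)), Real.logb_pow]
    push_cast
    rfl
  have hinv : Real.logb b (w (a (Fin.last d))⁻¹) ≤ u := by
    rw [hu]
    exact le_max_right _ _
  have hterm (i : Fin d) : w (a i.castSucc * y ^ q ^ (i : ℕ)) <
      w (a (Fin.last d) * y ^ q ^ d) := by
    have hpos : 0 < w (a (Fin.last d) * y ^ q ^ d) := w.pos (mul_ne_zero ha (pow_ne_zero _ hy))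
    rcases eq_or_ne (a i.castSucc) 0 with h0 | h0
    · rwa [h0, zero_mul, map_zero]
    have hpos' : 0 < w (a i.castSucc * y ^ q ^ (i : ℕ)) :=
      w.pos (mul_ne_zero h0 (pow_ne_zero _ hy))
    rw [← Real.logb_lt_logb_iff hb hpos' hpos, hlast, map_mul, map_pow,
      Real.logb_mul ((_root_.map_ne_zero _).2 h0) (pow_ne_zero _ ((_root_.map_ne_zero _).2 hy)),
      Real.logb_pow]
    have h1 : Real.logb b (w (a i.castSucc)) ≤ s := (le_max_right _ _).trans (hle _)
    have h2 : 2 * (q : ℝ) ^ (i : ℕ) ≤ (q : ℝ) ^ d := by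
      have h3 : 2 * q ^ (i : ℕ) ≤ q ^ d := by
        calc 2 * q ^ (i : ℕ) ≤ q * q ^ (i : ℕ) := by gcongr
          _ = q ^ ((i : ℕ) + 1) := by rw [pow_succ, mul_comm]
          _ ≤ q ^ d := Nat.pow_le_pow_right (by omega) i.2
      exact_mod_cast h3
    have h4 := mul_le_mul_of_nonneg_right h2 ht0.le
    push_cast
    change _ + (q : ℝ) ^ (i : ℕ) * t < _
    linarith
  have hrest : w (∑ i : Fin d, a i.castSucc * y ^ q ^ (i : ℕ)) <
      w (a (Fin.last d) * y ^ q ^ d) := by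
    have : Nonempty (Fin d) := ⟨⟨0, hd⟩⟩
    obtain ⟨i, -, hi⟩ := hw.finset_image_add_of_nonempty
      (fun i : Fin d => a i.castSucc * y ^ q ^ (i : ℕ)) Finset.univ_nonempty
    exact hi.trans_lt (hterm i)
  have htot : w (∑ i, a i * y ^ q ^ (i : ℕ)) = w (a (Fin.last d) * y ^ q ^ d) := by
    rw [Fin.sum_univ_castSucc]
    exact hw.add_eq_right_of_lt hrest
  rw [htot, hlast]
  have := le_max_right 0 (Real.logb b (w (a (Fin.last d))) + (q : ℝ) ^ d * t)
  linarith

end LocalEstimates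

/-! ### Global estimates -/

section GlobalEstimates

variable {F : Type*} [Field F] [Fintype F]

theorem height_nonneg (y : kbar F) : 0 ≤ height y := by
  have : FiniteDimensional (k F) (k F)⟮y⟯ :=
    IntermediateField.adjoin.finiteDimensional (Algebra.IsIntegral.isIntegral y)
  have h := height_eq (IntermediateField.AdjoinSimple.gen (k F) y)
  rw [IntermediateField.AdjoinSimple.coe_gen] at h
  rw [h]
  exact mul_nonneg (by positivity) (finsum_nonneg fun ω => le_max_left _ _)

theorem height_add_le (y z : kbar F) : height (y + z) ≤ height y + height z := by
  let K : IntermediateField (k F) (kbar F) := IntermediateField.adjoin (k F) {y, z}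
  have : FiniteDimensional (k F) K :=
    IntermediateField.finiteDimensional_adjoin fun x _ => Algebra.IsIntegral.isIntegral x
  let y' : K := ⟨y, IntermediateField.subset_adjoin _ _ (by simp)⟩
  let z' : K := ⟨z, IntermediateField.subset_adjoin _ _ (by simp)⟩
  have h := height_eq (y' + z')
  have h1 := height_eq y'
  have h2 := height_eq z'
  change height (y + z) = _ at h
  change height y = _ at h1
  change height z = _ at h2
  rw [h, h1, h2, ← mul_add, ← finsum_add_distrib (finite_support_posLog y')
    (finite_support_posLog z')]
  refine mul_le_mul_of_nonneg_left (finsum_le_finsum' (finite_support_posLog _)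
    (((finite_support_posLog y').union (finite_support_posLog z')).subset
      (Function.support_add _ _)) fun ω => ?_) (by positivity)
  exact posLog_add_le one_lt_card_real ω.isNonarchimedean_abv y' z'

theorem height_zero : height (0 : kbar F) = 0 := by
  have h := height_eq (0 : (⊥ : IntermediateField (k F) (kbar F)))
  rw [ZeroMemClass.coe_zero] at h
  rw [h]
  simp

theorem height_sum_le {ι : Type*} (s : Finset ι) (z : ι → kbar F) :
    height (∑ i ∈ s, z i) ≤ ∑ i ∈ s, height (z i) := by
  classical
  induction s using Finset.induction_on with
  | empty => simp [height_zero]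
  | insert i s hi ih =>
    rw [Finset.sum_insert hi, Finset.sum_insert hi]
    exact (height_add_le _ _).trans (by gcongr)

theorem height_smul_le (c : F) (y : kbar F) : height (c • y) ≤ height y := by
  rcases eq_or_ne c 0 with rfl | hc
  · rw [zero_smul, height_zero]
    exact height_nonneg y
  let K : IntermediateField (k F) (kbar F) := (k F)⟮y⟯
  have : FiniteDimensional (k F) K :=
    IntermediateField.adjoin.finiteDimensional (Algebra.IsIntegral.isIntegral y)
  let y' : K := IntermediateField.AdjoinSimple.gen (k F) y
  have h := height_eq (algebraMap (k F) K (algebraMap F (k F) c) * y')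
  have h1 := height_eq y'
  have hcoe : ((algebraMap (k F) K (algebraMap F (k F) c) * y' : K) : kbar F) = c • y := by
    rw [Algebra.smul_def, IsScalarTower.algebraMap_apply F (k F) (kbar F)]
    rfl
  change height y = _ at h1
  rw [hcoe] at h
  rw [h, h1]
  refine le_of_eq ?_
  congr 1
  refine finsum_congr fun ω => ?_
  rw [map_mul, Embedding.abv_apply ω (algebraMap (k F) K _), AlgHom.commutes, abvCv_algebraMap,
    abv_algebraMap_constant _ hc, one_mul]

namespace DrinfeldModule

variable {d : ℕ} (Φ : DrinfeldModule F d)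

theorem finiteDimensional_coeffField : FiniteDimensional (k F) Φ.coeffField :=
  IntermediateField.finiteDimensional_adjoin fun x _ => Algebra.IsIntegral.isIntegral x

theorem tau_pow_apply (n : ℕ) (y : kbar F) : (tau F ^ n) y = y ^ Fintype.card F ^ n := by
  induction n generalizing y with
  | zero => simp
  | succ n ih =>
    rw [pow_succ, Module.End.mul_apply, ih]
    change (y ^ Fintype.card F) ^ Fintype.card F ^ n = _
    rw [← pow_mul, pow_succ, mul_comm]

theorem act_X (y : kbar F) :
    Φ.act X y = ∑ i : Fin (d + 1), Φ.coeff i * y ^ Fintype.card F ^ (i : ℕ) := by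
  rw [act, Φ.map_T, LinearMap.sum_apply]
  refine Finset.sum_congr rfl fun i _ => ?_
  rw [Module.End.mul_apply, tau_pow_apply, LinearMap.mulLeft_apply]

theorem act_mul (a b : F[X]) (y : kbar F) : Φ.act (a * b) y = Φ.act a (Φ.act b y) := by
  simp only [act, map_mul]
  rfl

theorem act_sub (a b : F[X]) (y : kbar F) : Φ.act (a - b) y = Φ.act a y - Φ.act b y := by
  simp only [act, map_sub]
  rfl

theorem act_sum_monomial {N : ℕ} {a : F[X]} (ha : a.natDegree < N) (y : kbar F) :
    Φ.act a y = ∑ i ∈ Finset.range N, a.coeff i • Φ.act (X ^ i) y := by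
  conv_lhs => rw [a.as_sum_range' N ha]
  simp only [act, ← smul_X_eq_monomial, map_sum, map_smul, AddSubmonoidClass.coe_finsetSum,
    LinearMap.sum_apply]
  rfl

theorem act_X_mem {K : IntermediateField (k F) (kbar F)} (hK : Φ.coeffField ≤ K) {y : kbar F}
    (hy : y ∈ K) : Φ.act X y ∈ K := by
  rw [act_X]
  exact sum_mem fun i _ => mul_mem (hK (Φ.coeff_mem i)) (pow_mem hy _)

theorem act_X_pow_succ (n : ℕ) (y : kbar F) : Φ.act (X ^ (n + 1)) y = Φ.act X (Φ.act (X ^ n) y) := by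
  rw [pow_succ', act_mul]

theorem act_X_pow_zero (y : kbar F) : Φ.act (X ^ 0) y = y := by
  simp [act]

theorem act_mem {K : IntermediateField (k F) (kbar F)} (hK : Φ.coeffField ≤ K) (a : F[X])
    {y : kbar F} (hy : y ∈ K) : Φ.act a y ∈ K := by
  have hpow (n : ℕ) : Φ.act (X ^ n) y ∈ K := by
    induction n with
    | zero => rwa [act_X_pow_zero]
    | succ n ih =>
      rw [act_X_pow_succ]
      exact Φ.act_X_mem hK ih
  rw [Φ.act_sum_monomial (Nat.lt_succ_self _)]
  refine sum_mem fun i _ => ?_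
  rw [Algebra.smul_def, IsScalarTower.algebraMap_apply F (k F) (kbar F)]
  exact mul_mem (K.algebraMap_mem _) (hpow i)

theorem modHeight_nonneg : 0 ≤ Φ.modHeight := by
  have := Φ.finiteDimensional_coeffField
  rw [modHeight, heightOver_eq_finsum]
  refine mul_nonneg (by positivity) (finsum_nonneg fun ω => ?_)
  exact Real.iSup_nonneg fun i => le_max_left _ _

theorem finite_support_iSup_posLog {K : Type*} [Field K] [Algebra (k F) K]
    [FiniteDimensional (k F) K] {ι : Type*} [Finite ι] (a : ι → K) :
    (Function.support fun ω : Embedding (F := F) K =>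
      ⨆ i, max 0 (Real.logb (Fintype.card F) (ω.abv (a i)))).Finite := by
  refine (Set.finite_iUnion fun i => finite_support_posLog (F := F) (a i)).subset fun ω hω => ?_
  by_contra h
  simp only [Set.mem_iUnion, not_exists, Function.mem_support, not_not] at h
  exact hω (by simp [h])

/-- The two sided comparison of the heights of `Φ(T)(y)` and `y`. -/
theorem height_act_X (y : kbar F) :
    height (Φ.act X y) ≤ (Fintype.card F : ℝ) ^ d * height y + Φ.modHeight ∧
      (Fintype.card F : ℝ) ^ d * height y ≤ height (Φ.act X y) + 4 * Φ.modHeight := by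
  have := Φ.finiteDimensional_coeffField
  have : FiniteDimensional (k F) (k F)⟮y⟯ :=
    IntermediateField.adjoin.finiteDimensional (Algebra.IsIntegral.isIntegral y)
  let K : IntermediateField (k F) (kbar F) := Φ.coeffField ⊔ (k F)⟮y⟯
  have : FiniteDimensional (k F) K := IntermediateField.finiteDimensional_sup _ _
  let y' : K := ⟨y, (le_sup_right : (k F)⟮y⟯ ≤ K) (IntermediateField.mem_adjoin_simple_self _ _)⟩
  let a : Fin (d + 1) → K := fun i => ⟨Φ.coeff i, (le_sup_left : Φ.coeffField ≤ K) (Φ.coeff_mem i)⟩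
  have ha : a (Fin.last d) ≠ 0 := fun h => Φ.coeff_last (congrArg Subtype.val h)
  have hy := height_eq y'
  have hTy := height_eq (∑ i, a i * y' ^ Fintype.card F ^ (i : ℕ))
  have hmod : Φ.modHeight = (1 / (Field.finSepDegree (k F) K : ℝ)) *
      ∑ᶠ ω : Embedding (F := F) K, ⨆ i, max 0 (Real.logb (Fintype.card F) (ω.abv (a i))) :=
    heightOver_eq_of_le le_sup_left _
  have hcoe : ((∑ i, a i * y' ^ Fintype.card F ^ (i : ℕ) : K) : kbar F) = Φ.act X y := by
    rw [act_X, AddSubmonoidClass.coe_finsetSum]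
    rfl
  rw [hcoe] at hTy
  change height y = _ at hy
  have fy := finite_support_posLog (F := F) y'
  have fT := finite_support_posLog (F := F) (∑ i, a i * y' ^ Fintype.card F ^ (i : ℕ))
  have fa := finite_support_iSup_posLog (F := F) a
  have fd := finite_support_posLog (F := F) (a (Fin.last d))⁻¹
  -- By the product formula `a_d` and its inverse have the same height, at most `h(Φ)`. The local
  -- error `2(s + u)` thus sums to at most `4 h(Φ)`.
  have hinv : ∑ᶠ ω : Embedding (F := F) K,
      max 0 (Real.logb (Fintype.card F) (ω.abv (a (Fin.last d))⁻¹)) ≤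
        ∑ᶠ ω : Embedding (F := F) K, ⨆ i, max 0 (Real.logb (Fintype.card F) (ω.abv (a i))) := by
    have fl := finite_support_logb (F := F) (a (Fin.last d))
    have hle : ∑ᶠ ω : Embedding (F := F) K,
        max 0 (Real.logb (Fintype.card F) (ω.abv (a (Fin.last d)))) ≤
        ∑ᶠ ω : Embedding (F := F) K, ⨆ i, max 0 (Real.logb (Fintype.card F) (ω.abv (a i))) :=
      finsum_le_finsum' (finite_support_posLog _) fa fun ω =>
        le_ciSup (f := fun i => max 0 (Real.logb (Fintype.card F) (ω.abv (a i))))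
          (Set.finite_range _).bddAbove (Fin.last d)
    have heq : ∑ᶠ ω : Embedding (F := F) K,
        max 0 (Real.logb (Fintype.card F) (ω.abv (a (Fin.last d)))) =
        ∑ᶠ ω : Embedding (F := F) K,
          max 0 (Real.logb (Fintype.card F) (ω.abv (a (Fin.last d))⁻¹)) := by
      have h := finsum_add_distrib fd fl
      rw [productFormula ha, add_zero] at h
      rw [← h]
      refine finsum_congr fun ω => ?_
      rw [map_inv₀, Real.logb_inv]
      rcases le_total 0 (Real.logb (Fintype.card F) (ω.abv (a (Fin.last d)))) with h | h
      · rw [max_eq_right h, max_eq_left (by linarith), zero_add]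
      · rw [max_eq_left h, max_eq_right (by linarith), neg_add_cancel]
    rwa [← heq]
  set N : ℝ := 1 / (Field.finSepDegree (k F) K : ℝ) with hN
  have hN0 : 0 ≤ N := by positivity
  have fqy : (Function.support fun ω : Embedding (F := F) K => (Fintype.card F : ℝ) ^ d *
      max 0 (Real.logb (Fintype.card F) (ω.abv y'))).Finite :=
    fy.subset fun ω hω h => hω (by simp only [h, mul_zero])
  constructor
  · have h := finsum_le_finsum' fT ((fqy.union fa).subset (Function.support_add _ _)) fun ω =>
      posLog_sum_pow_le one_lt_card_real ω.isNonarchimedean_abv Fintype.card_pos a y'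
    rw [finsum_add_distrib fqy fa, ← const_mul_finsum] at h
    have := mul_le_mul_of_nonneg_left h hN0
    rw [hTy, hy, hmod]
    linarith
  · have fs : (Function.support fun ω : Embedding (F := F) K => 2 *
        ((⨆ i, max 0 (Real.logb (Fintype.card F) (ω.abv (a i)))) +
          max 0 (Real.logb (Fintype.card F) (ω.abv (a (Fin.last d))⁻¹)))).Finite := by
      refine (fa.union fd).subset fun ω hω => ?_
      by_contra h
      simp only [Set.mem_union, Function.mem_support, not_or, not_not] at h
      exact hω (by simp only [h.1, h.2, add_zero, mul_zero])
    have h := finsum_le_finsum' fqy ((fT.union fs).subset (Function.support_add _ _)) fun ω =>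
      posLog_sum_pow_ge one_lt_card_real ω.isNonarchimedean_abv Fintype.one_lt_card Φ.rank_pos a
        ha y'
    rw [finsum_add_distrib fT fs, ← const_mul_finsum, ← const_mul_finsum,
      finsum_add_distrib fa fd] at h
    have h1 := mul_le_mul_of_nonneg_left h hN0
    have h2 := mul_le_mul_of_nonneg_left hinv hN0
    rw [hTy, hy, hmod]
    linarith

end DrinfeldModule

end GlobalEstimates

/-! ### The canonical height -/

namespace DrinfeldModule

variable {F : Type*} [Field F] [Fintype F] {d : ℕ} (Φ : DrinfeldModule F d)

theorem two_le_card_pow (Φ : DrinfeldModule F d) : (2 : ℝ) ≤ (Fintype.card F : ℝ) ^ d := by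
  have h2 : (2 : ℝ) ≤ Fintype.card F := by exact_mod_cast Fintype.one_lt_card (α := F)
  exact h2.trans (le_self_pow₀ (by linarith) Φ.rank_pos.ne')

theorem heightSeq_eq (x : kbar F) (n : ℕ) :
    Φ.heightSeq x n = height (Φ.act (X ^ n) x) / ((Fintype.card F : ℝ) ^ d) ^ n := by
  rw [heightSeq, pow_mul]

theorem heightSeq_nonneg (x : kbar F) (n : ℕ) : 0 ≤ Φ.heightSeq x n :=
  div_nonneg (height_nonneg _) (by positivity)

/-- Consecutive terms differ by `O(q^{-dn})`, so the sequence is Cauchy and the value of `limUnder`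
is a genuine limit. -/
theorem tendsto_heightSeq (x : kbar F) :
    Filter.Tendsto (Φ.heightSeq x) Filter.atTop (nhds (Φ.canonicalHeight x)) := by
  set Q : ℝ := (Fintype.card F : ℝ) ^ d with hQ
  have hQ2 : 2 ≤ Q := Φ.two_le_card_pow
  have hQ0 : 0 < Q := by linarith
  have hm := Φ.modHeight_nonneg
  have hc : CauchySeq (Φ.heightSeq x) := by
    refine cauchySeq_of_le_geometric Q⁻¹ (4 * Φ.modHeight) (inv_lt_one_of_one_lt₀ (by linarith))
      fun n => ?_
    obtain ⟨h1, h2⟩ := Φ.height_act_X (Φ.act (X ^ n) x)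
    rw [← act_X_pow_succ] at h1 h2
    have hpow : 0 < Q ^ (n + 1) := by positivity
    have hdiff : Φ.heightSeq x n - Φ.heightSeq x (n + 1) =
        (Q * height (Φ.act (X ^ n) x) - height (Φ.act (X ^ (n + 1)) x)) / Q ^ (n + 1) := by
      rw [heightSeq_eq, heightSeq_eq, ← hQ, pow_succ Q]
      field_simp
    rw [Real.dist_eq, hdiff, abs_div, abs_of_pos hpow, div_le_iff₀ hpow]
    have h3 : 4 * Φ.modHeight * Q⁻¹ ^ n * Q ^ (n + 1) = 4 * Φ.modHeight * Q := by
      rw [pow_succ, inv_pow]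
      field_simp
    rw [h3]
    have h4 : 4 * Φ.modHeight ≤ 4 * Φ.modHeight * Q :=
      le_mul_of_one_le_right (by positivity) (by linarith)
    rw [abs_le]
    constructor <;> linarith
  exact tendsto_nhds_limUnder (cauchySeq_tendsto_of_complete hc)

theorem canonicalHeight_nonneg (x : kbar F) : 0 ≤ Φ.canonicalHeight x :=
  ge_of_tendsto' (Φ.tendsto_heightSeq x) (Φ.heightSeq_nonneg x)

/-- Because `q^d ≥ 2`, the quantity `h - 4 h(Φ)` is multiplied by at least `q^d` under `Φ(T)`. The
shift by `4 h(Φ)` is what lets the induction close. -/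
theorem le_height_act_X_pow (y : kbar F) (m : ℕ) :
    ((Fintype.card F : ℝ) ^ d) ^ m * (height y - 4 * Φ.modHeight) + 4 * Φ.modHeight ≤
      height (Φ.act (X ^ m) y) := by
  have hQ2 := Φ.two_le_card_pow
  have hm := Φ.modHeight_nonneg
  induction m with
  | zero =>
    rw [act_X_pow_zero]
    simp
  | succ m ih =>
    have h := (Φ.height_act_X (Φ.act (X ^ m) y)).2
    rw [← act_X_pow_succ] at h
    have h1 := mul_le_mul_of_nonneg_left ih (by linarith : (0 : ℝ) ≤ (Fintype.card F : ℝ) ^ d)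
    have h2 := mul_le_mul_of_nonneg_right hQ2 hm
    rw [pow_succ]
    nlinarith

theorem sum_range_pow_le {Q : ℝ} (hQ : 2 ≤ Q) (N : ℕ) : ∑ i ∈ Finset.range N, Q ^ i ≤ Q ^ N := by
  induction N with
  | zero => simp
  | succ N ih =>
    rw [Finset.sum_range_succ, pow_succ]
    have : 0 ≤ Q ^ N := by positivity
    nlinarith

/-- The multiples `Φ(a)(x)` have small height if the canonical height of `x` is small. -/
theorem height_act_le (x : kbar F) {N : ℕ} {a : F[X]} (ha : a.natDegree < N) :
    height (Φ.act a x) ≤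
      4 * Φ.modHeight + ((Fintype.card F : ℝ) ^ d) ^ N * Φ.canonicalHeight x := by
  set Q : ℝ := (Fintype.card F : ℝ) ^ d with hQ
  have hQ2 : 2 ≤ Q := Φ.two_le_card_pow
  have hQ0 : 0 < Q := by linarith
  have hm := Φ.modHeight_nonneg
  -- Apply `Φ(T^m)`, which commutes with `Φ(a)`, expand `a` in monomials and divide by `q^{dm}`.
  -- Constants do not increase the height, and letting `m → ∞` turns the right side into multiples
  -- of `ĥ(x)`.
  have hbound (m : ℕ) : height (Φ.act a x) - 4 * Φ.modHeight ≤
      ∑ i ∈ Finset.range N, Q ^ i * Φ.heightSeq x (i + m) := by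
    have h1 := Φ.le_height_act_X_pow (Φ.act a x) m
    have h2 : height (Φ.act (X ^ m) (Φ.act a x)) ≤
        ∑ i ∈ Finset.range N, height (Φ.act (X ^ (i + m)) x) := by
      rw [← act_mul, mul_comm, act_mul, Φ.act_sum_monomial ha]
      refine (height_sum_le _ _).trans (Finset.sum_le_sum fun i _ => ?_)
      rw [← act_mul, ← pow_add]
      exact height_smul_le _ _
    have h3 : ∑ i ∈ Finset.range N, height (Φ.act (X ^ (i + m)) x) =
        Q ^ m * ∑ i ∈ Finset.range N, Q ^ i * Φ.heightSeq x (i + m) := by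
      rw [Finset.mul_sum]
      refine Finset.sum_congr rfl fun i _ => ?_
      rw [heightSeq_eq, ← hQ, pow_add Q]
      field_simp
    have hpow : 0 < Q ^ m := by positivity
    refine le_of_mul_le_mul_left ?_ hpow
    rw [← h3]
    linarith
  have hlim : Filter.Tendsto (fun m => ∑ i ∈ Finset.range N, Q ^ i * Φ.heightSeq x (i + m))
      Filter.atTop (nhds (∑ i ∈ Finset.range N, Q ^ i * Φ.canonicalHeight x)) := by
    refine tendsto_finsetSum _ fun i _ => Filter.Tendsto.const_mul _ ?_
    exact (Φ.tendsto_heightSeq x).comp (Filter.tendsto_atTop_mono (fun m => Nat.le_add_left m i)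
      Filter.tendsto_id)
  have h := ge_of_tendsto' hlim hbound
  rw [← Finset.sum_mul] at h
  have h4 := mul_le_mul_of_nonneg_right (sum_range_pow_le hQ2 N) (Φ.canonicalHeight_nonneg x)
  linarith

/-- The lower bound for the canonical height, in terms of the degree of a field of definition. -/
theorem one_lt_pow_mul_canonicalHeight {x : kbar F} (hx : ¬ Φ.IsTorsion x) {n N : ℕ} (hN : 0 < N)
    (hn : Module.finrank (k F) ↥((k F)⟮x⟯ ⊔ Φ.coeffField) ≤ n) {H : ℝ}
    (hH : 4 * Φ.modHeight + 1 ≤ H) (hNn : n - 1 + (⌊n * H⌋₊ + 1) * (n + 1) < N) :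
    1 < ((Fintype.card F : ℝ) ^ d) ^ N * Φ.canonicalHeight x := by
  classical
  by_contra! hsmall
  have := Φ.finiteDimensional_coeffField
  have : FiniteDimensional (k F) (k F)⟮x⟯ :=
    IntermediateField.adjoin.finiteDimensional (Algebra.IsIntegral.isIntegral x)
  set K : IntermediateField (k F) (kbar F) := (k F)⟮x⟯ ⊔ Φ.coeffField with hK
  have : FiniteDimensional (k F) K := IntermediateField.finiteDimensional_sup _ _
  have hH0 : 0 ≤ H := by linarith [Φ.modHeight_nonneg]
  let pt (f : Fin N → F) : kbar F := Φ.act ((degreeLTEquiv F N).symm f : F[X]) x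
  -- A collision would make the difference of two distinct polynomials annihilate `x`.
  have hinj : Function.Injective pt := fun f g h => by
    by_contra hne
    refine hx ⟨((degreeLTEquiv F N).symm f : F[X]) - (degreeLTEquiv F N).symm g, ?_, ?_⟩
    · rw [sub_ne_zero]
      exact fun h' => hne ((degreeLTEquiv F N).symm.injective (Subtype.ext h'))
    · rw [act_sub, sub_eq_zero]
      exact h
  let S : Finset (kbar F) := Finset.univ.image pt
  have hcard : S.card = Fintype.card F ^ N := by
    rw [Finset.card_image_of_injective _ hinj, Finset.card_univ, Fintype.card_fun, Fintype.card_fin]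
  have hdeg : ∀ y ∈ S, (minpoly (k F) y).natDegree ≤ n := by
    intro y hy
    obtain ⟨f, -, rfl⟩ := Finset.mem_image.1 hy
    have hmem : pt f ∈ K := Φ.act_mem le_sup_right _
      ((le_sup_left : (k F)⟮x⟯ ≤ K) (IntermediateField.mem_adjoin_simple_self _ _))
    have h := minpoly.natDegree_le (A := k F) (⟨pt f, hmem⟩ : K)
    rw [IntermediateField.minpoly_eq] at h
    exact h.trans hn
  have hheight : ∀ y ∈ S, (minpoly (k F) y).natDegree * height y < (⌊n * H⌋₊ : ℝ) + 1 := by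
    intro y hy
    have hd := hdeg y hy
    obtain ⟨f, -, rfl⟩ := Finset.mem_image.1 hy
    have hnat : (((degreeLTEquiv F N).symm f : degreeLT F N) : F[X]).natDegree < N := by
      have hlt := mem_degreeLT.1 ((degreeLTEquiv F N).symm f).2
      by_cases h0 : (((degreeLTEquiv F N).symm f : degreeLT F N) : F[X]) = 0
      · rwa [h0, natDegree_zero]
      · exact (natDegree_lt_iff_degree_lt h0).2 hlt
    have hle : height (pt f) ≤ H := (Φ.height_act_le x hnat).trans (by linarith)
    calc (minpoly (k F) (pt f)).natDegree * height (pt f) ≤ n * H :=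
          mul_le_mul (by exact_mod_cast hd) hle (height_nonneg _) (by positivity)
      _ < _ := Nat.lt_floor_add_one _
  have hcount := card_le_of_height_le n ⌊n * H⌋₊ S hdeg hheight
  rw [hcard] at hcount
  have hq : 2 ≤ Fintype.card F := Fintype.one_lt_card
  -- This moves the factor `n` of the Northcott count into the exponent, whence the term `n - 1` in
  -- `hNn`.
  have hn2 : n ≤ Fintype.card F ^ (n - 1) := by
    have h1 : n - 1 < 2 ^ (n - 1) := Nat.lt_two_pow_self
    have h2 : 2 ^ (n - 1) ≤ Fintype.card F ^ (n - 1) := Nat.pow_le_pow_left hq _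
    omega
  have hfinal : Fintype.card F ^ N ≤
      Fintype.card F ^ (n - 1 + (⌊n * H⌋₊ + 1) * (n + 1)) := by
    rw [pow_add]
    exact hcount.trans (Nat.mul_le_mul_right _ hn2)
  exact absurd ((Nat.pow_le_pow_iff_right (by omega)).1 hfinal) (not_le.2 hNn)

end DrinfeldModule

end DrinfeldHeight

end

/-! ### The explicit lower bound -/

open DrinfeldHeight in
theorem mainTheorem6 (F : Type*) [Field F] [Fintype F] (d : ℕ) (Φ : DrinfeldModule F d)
    (c₂ : ℝ)
    (hc₂ : c₂ = (Fintype.card F : ℝ) ^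
      (5 * (d : ℝ) * (2 * ((d : ℝ) + 1) * Φ.modHeight + 1) * (Φ.coeffDegree : ℝ) ^ 2))
    (x : kbar F) (hx : ¬ Φ.IsTorsion x)
    (D : ℕ) (hD : D = Module.finrank (k F) (IntermediateField.adjoin (k F) {x})) :
    Filter.Tendsto (Φ.heightSeq x) Filter.atTop (nhds (Φ.canonicalHeight x)) ∧
      1 / c₂ ^ (D ^ 2) ≤ Φ.canonicalHeight x := by
  refine ⟨Φ.tendsto_heightSeq x, ?_⟩
  set q : ℝ := (Fintype.card F : ℝ) with hq
  have hq1 : 1 < q := one_lt_card_real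
  have hq0 : 0 < q := by linarith
  have hm := Φ.modHeight_nonneg
  have hd : (1 : ℝ) ≤ d := by exact_mod_cast Φ.rank_pos
  set H : ℝ := 2 * ((d : ℝ) + 1) * Φ.modHeight + 1 with hHdef
  -- Here `d ≥ 1` gives `2(d + 1) ≥ 4`.
  have hH4 : 4 * Φ.modHeight + 1 ≤ H := by nlinarith
  have hH1 : 1 ≤ H := by linarith
  have := Φ.finiteDimensional_coeffField
  have : FiniteDimensional (k F) (IntermediateField.adjoin (k F) {x}) :=
    IntermediateField.adjoin.finiteDimensional (Algebra.IsIntegral.isIntegral x)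
  have hD0 : 0 < D := hD ▸ Module.finrank_pos
  have hc0 : 0 < Φ.coeffDegree := Module.finrank_pos
  set n : ℕ := D * Φ.coeffDegree with hn
  have hn0 : 0 < n := Nat.mul_pos hD0 hc0
  have hn1 : (1 : ℝ) ≤ n := by exact_mod_cast hn0
  have hdegree : Module.finrank (k F)
      ↥(IntermediateField.adjoin (k F) {x} ⊔ Φ.coeffField) ≤ n := by
    rw [hn, hD]
    exact IntermediateField.finrank_sup_le _ _
  -- The exponent to beat is at most `(n - 1) + (nH + 1)(n + 1) = Hn² + Hn + 2n ≤ 4Hn²`. A fifth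
  -- `Hn² ≥ 1` makes up for the rounding in `N > 5Hn² - 1`.
  set N : ℕ := ⌊5 * H * (n : ℝ) ^ 2⌋₊ with hN
  have hNle : (N : ℝ) ≤ 5 * H * (n : ℝ) ^ 2 := Nat.floor_le (by positivity)
  have hNlt : 5 * H * (n : ℝ) ^ 2 < N + 1 := Nat.lt_floor_add_one _
  have hnn : (n : ℝ) ≤ (n : ℝ) ^ 2 := by nlinarith
  have hHn : (n : ℝ) ^ 2 ≤ H * (n : ℝ) ^ 2 := le_mul_of_one_le_left (by positivity) hH1
  have hNn : n - 1 + (⌊n * H⌋₊ + 1) * (n + 1) < N := by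
    have hfloor : (⌊n * H⌋₊ : ℝ) ≤ n * H := Nat.floor_le (by positivity)
    have hcast : ((n - 1 + (⌊n * H⌋₊ + 1) * (n + 1) : ℕ) : ℝ) < N := by
      rw [Nat.cast_add, Nat.cast_sub hn0]
      push_cast
      have h1 : ((⌊n * H⌋₊ : ℝ) + 1) * (n + 1) ≤ (n * H + 1) * (n + 1) := by gcongr
      have h2 : (n : ℝ) * H ≤ H * (n : ℝ) ^ 2 := by nlinarith
      nlinarith
    exact_mod_cast hcast
  have hmain := Φ.one_lt_pow_mul_canonicalHeight hx (by omega) hdegree hH4 hNn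
  -- Since `n = D c(Φ)`, the exponent of `c₂^{D²}` is exactly `d` times the real number whose floor
  -- is `N`.
  have hpow : c₂ ^ D ^ 2 = q ^ (d * (5 * H * (n : ℝ) ^ 2)) := by
    rw [hc₂, ← Real.rpow_natCast, ← Real.rpow_mul hq0.le]
    congr 1
    rw [hn]
    push_cast
    ring
  have hle : (q ^ d) ^ N ≤ c₂ ^ D ^ 2 := by
    rw [hpow, ← pow_mul, ← Real.rpow_natCast]
    refine Real.rpow_le_rpow_of_exponent_le hq1.le ?_
    push_cast
    gcongr
  have hpos : 0 < c₂ ^ D ^ 2 := lt_of_lt_of_le (by positivity) hle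
  rw [div_le_iff₀ hpos, mul_comm]
  exact hmain.le.trans (mul_le_mul_of_nonneg_right hle (Φ.canonicalHeight_nonneg x))
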